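/- **Setting.** The state $\omega\in[0,1]$ has distribution function $F$ with a density, and $F^{-1}$ is its quantile function. The receiver has a type $\theta$ in a finite set $\Theta$, independent of $\omega$, with probabilities $g(\theta)>0$, and chooses one of finitely many actions $a\in A=\{1,\dots,|A|\}$. His utility is $u(a,\omega,\theta)=u_1(a,\theta)\,\omega+u_2(a,\theta)$; the designer's utility is $v(a,\theta)$. A *signal* $\mu$ maps states to distributions $\mu(\cdot\mid\omega)$ over messages. A *mechanism* is a menu $M$ of signals, from which the receiver, knowing his type, chooses one signal; he then observes its message and takes an action. A strategy (a signal $\mu^\theta\in M$ and an action $a^\theta(s)$ after each message $s$, for every type $\theta$) is *optimal* for the receiver if for every $\theta$, for almost every message $s$ of $\mu^\theta$, $a^\theta(s)$ maximizes $\mathbb E_{\mu^\theta}[u(\cdot,\omega,\theta)\mid s]$, and if $\mu^\theta$ maximizes $\int\!\int\max_b\mathbb E_\nu[u(b,\omega,\theta)\mid s]\,d\nu(s\mid\omega)\,dF(\omega)$ over $\nu\in M$. The designer's problem is to maximize $\sum_\theta g(\theta)\int\!\int v(a^\theta(s),\theta)\,d\mu^\theta(s\mid\omega)\,dF(\omega)$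 over mechanisms (with arbitrary message spaces) and optimal strategies of the receiver. A *recommendation mechanism* consists of one signal $\mu^\theta$ per type, with message space $A$; the menu is $\{\mu^\theta\}_{\theta\in\Theta}$, type $\theta$ chooses $\mu^\theta$ and takes the recommended action. It is *incentive compatible* if this strategy is optimal for the receiver, and *optimal* if it moreover solves the designer's problem. We say that it *induces* $(p,z)$ if for all $a,\theta$ it recommends $a$ to type $\theta$ with probability $p_{a,\theta}$, this recommendation induces the posterior mean $z_{a,\theta}/p_{a,\theta}$ when $p_{a,\theta}>0$, and $z_{a,\theta}=0$ when $p_{a,\theta}=0$ (that is, $z=p\cdot m$ with $m$ the posterior means). The actions are labelled, separately for each type, so that there are cutoffs $0=b_{0,\theta}\le b_{1,\theta}\le\dots\le b_{|A|,\theta}=1$ such that, for each action $a$ that is optimal for type $\theta$ at some posterior mean in $[0,1]$, $a$ is optimal for $\theta$ at the posterior mean $m\in[0,1]$ if and only if $m\in[b_{a-1,\theta},b_{a,\theta}]$, and $b_{a-1,\theta}=b_{a,\theta}=1$ for each action $a$ that is optimal for $\theta$ at no posterior mean. Put $c_{a,\theta}=u_1(a,\theta)$ and $h_{a,\theta}=u_2(a,\theta)+u_1(a,\theta)b_{a,\theta}$.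 **The program (OPT).** Over $p,z\in\mathbb R^{A\times\Theta}$ and $y\in\mathbb R^{A\times\Theta\times\Theta}$, maximize $\sum_\theta g(\theta)\sum_a p_{a,\theta}v(a,\theta)$ subject to, for all $\theta,\theta'\in\Theta$ and $a,a'\in A$, - $p_{a,\theta}\ge0$ and $\sum_a p_{a,\theta}=1$; - $\sum_{a\ge\ell}z_{a,\theta}\le\int_{1-\sum_{a\ge\ell}p_{a,\theta}}^1F^{-1}(x)\,dx$ for all $\ell>1$, and $\sum_az_{a,\theta}=\int_0^1F^{-1}(x)\,dx$; - $h_{a,\theta}p_{a',\theta'}+c_{a,\theta}(z_{a',\theta'}-b_{a,\theta}p_{a',\theta'})\le y_{a',\theta,\theta'}$; - $\sum_{a'}y_{a',\theta,\theta'}\le\sum_a\big[h_{a,\theta}p_{a,\theta}+c_{a,\theta}(z_{a,\theta}-b_{a,\theta}p_{a,\theta})\big]$; - $p_{a,\theta}b_{a-1,\theta}\le z_{a,\theta}\le p_{a,\theta}b_{a,\theta}$. **Proposition.** 1. (OPT) is a convex program: its feasible set is convex and its objective is linear. It has an optimal solution. 2. (OPT) is equivalent to the designer's problem: $(p,z)$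 extends to a feasible point $(p,z,y)$ of (OPT) if and only if it is induced by some incentive compatible recommendation mechanism; the designer's payoff from a recommendation mechanism that induces $(p,z)$ is the value of the objective of (OPT) at $(p,z,y)$, for every $y$; and $(p,z)$ extends to an optimal solution of (OPT) if and only if it is induced by some optimal recommendation mechanism. 3. For every optimal solution $(p,z,y)$ of (OPT), every recommendation mechanism that induces $(p,z)$, i.e. recommends $a$ to type $\theta$ with probability $p_{a,\theta}$ and induces the posterior mean $z_{a,\theta}/p_{a,\theta}$, is optimal. Moreover, there is such an optimal mechanism in which the signal of each type is laminar partitional: there is a partition $(P_a^\theta)_{a\in A}$ of $[0,1]$ (empty cells allowed) such that $a$ is recommended exactly in the states in $P^\theta_a$, and the convex hulls of any two cells are nested or disjoint. -/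

import Mathlib

open MeasureTheory ProbabilityTheory Set
open scoped unitInterval

universe u w

namespace Persuasion

/-- Primitives of the persuasion problem with type set `Θ` and `k` actions. The state lives in
`[0,1]` (the type `I`). The receiver of type `θ` gets `u₁ a θ * ω + u₂ a θ` from action `a` in
state `ω`; the designer gets `v a θ`. -/
structure Environment (Θ : Type*) [Fintype Θ] (k : ℕ) where
  /-- density of the state -/
  f : I → ℝ
  f_measurable : Measurable f
  f_nonneg : ∀ ω, 0 ≤ f ω
  f_integral : ∫ ω, f ω = 1
  /-- probabilities of the types -/
  g : Θ → ℝ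
  g_pos : ∀ θ, 0 < g θ
  g_sum : ∑ θ, g θ = 1
  u₁ : Fin k → Θ → ℝ
  u₂ : Fin k → Θ → ℝ
  v : Fin k → Θ → ℝ

/-- A signal with message space `S`: a conditional distribution over messages for each state. -/
abbrev Signal (S : Type*) [MeasurableSpace S] : Type _ :=
  {μ : Kernel I S // IsMarkovKernel μ}

instance {S : Type*} [MeasurableSpace S] (μ : Signal S) : IsMarkovKernel μ.1 := μ.2

section

variable {Θ : Type*} [Fintype Θ] {k : ℕ} (E : Environment Θ k)

/-- The prior distribution of the state. -/
noncomputable def Environment.prior : Measure I :=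
  volume.withDensity (fun ω => ENNReal.ofReal (E.f ω))

instance : IsProbabilityMeasure E.prior := by
  constructor
  have hi : Integrable E.f := by
    by_contra h
    have h1 := E.f_integral
    rw [integral_undef h] at h1
    exact zero_ne_one h1
  rw [Environment.prior, withDensity_apply _ MeasurableSet.univ, Measure.restrict_univ,
    ← ofReal_integral_eq_lintegral_ofReal hi (Filter.Eventually.of_forall E.f_nonneg),
    E.f_integral, ENNReal.ofReal_one]

/-- The cumulative distribution function `F` of the state. -/
noncomputable def Environment.cdf (x : I) : ℝ := E.prior.real (Iic x)

/-- The quantile function `F⁻¹ q = inf {x ∈ [0,1] | q ≤ F x}`. -/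
noncomputable def Environment.quantile (q : ℝ) : ℝ := ((sInf {x : I | q ≤ E.cdf x} : I) : ℝ)

/-- Unconditional distribution of the message of a signal. -/
noncomputable def messageLaw {S : Type*} [MeasurableSpace S] (μ : Signal S) : Measure S :=
  μ.1 ∘ₘ E.prior

/-- The posterior belief about the state after message `s` of the signal `μ`. -/
noncomputable def belief {S : Type*} [MeasurableSpace S] (μ : Signal S) (s : S) : Measure I :=
  posterior μ.1 E.prior s

/-- The posterior mean of the state after message `s`. -/
noncomputable def posteriorMean {S : Type*} [MeasurableSpace S] (μ : Signal S) (s : S) : ℝ :=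
  ∫ ω, (ω : ℝ) ∂(belief E μ s)

/-- Expected utility of type `θ` from action `a` after message `s` of the signal `μ`. -/
noncomputable def actionUtility {S : Type*} [MeasurableSpace S] (μ : Signal S) (θ : Θ) (s : S)
    (a : Fin k) : ℝ :=
  ∫ ω, (E.u₁ a θ * (ω : ℝ) + E.u₂ a θ) ∂(belief E μ s)

/-- Expected utility of type `θ` who observes the signal `μ` and then acts optimally. -/
noncomputable def signalUtility {S : Type*} [MeasurableSpace S] (μ : Signal S) (θ : Θ) : ℝ :=
  ∫ ω, ∫ s, (⨆ a, actionUtility E μ θ s a) ∂(μ.1 ω) ∂E.prior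

end

/-- A mechanism (a menu of signals with messages in `S`) together with a strategy of the receiver:
the signal chosen by each type, and the action taken by each type after each message. -/
structure Design (Θ : Type*) (k : ℕ) (S : Type*) [MeasurableSpace S] where
  menu : Set (Signal S)
  choice : Θ → Signal S
  choice_mem : ∀ θ, choice θ ∈ menu
  action : Θ → S → Fin k
  action_measurable : ∀ θ, Measurable (action θ)

section

variable {Θ : Type*} [Fintype Θ] {k : ℕ} (E : Environment Θ k)

/-- The strategy of the receiver is optimal in the mechanism: actions are optimal after almost
every message, and each type chooses an optimal signal from the menu. -/
def Design.StrategyOptimal {S : Type*} [MeasurableSpace S] (D : Design Θ k S) : Prop :=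
  (∀ θ, ∀ᵐ s ∂(messageLaw E (D.choice θ)), ∀ b : Fin k,
    actionUtility E (D.choice θ) θ s b ≤ actionUtility E (D.choice θ) θ s (D.action θ s)) ∧
  ∀ θ, ∀ ν ∈ D.menu, signalUtility E ν θ ≤ signalUtility E (D.choice θ) θ

/-- The designer's expected utility. -/
noncomputable def Design.payoff {S : Type*} [MeasurableSpace S] (D : Design Θ k S) : ℝ :=
  ∑ θ, E.g θ * ∫ ω, ∫ s, E.v (D.action θ s) θ ∂((D.choice θ).1 ω) ∂E.prior

end

/-- The design solves the designer's problem: the strategy of the receiver is optimal, and no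
mechanism with an optimal strategy of the receiver, whatever its message space and its menu,
gives the designer a higher payoff. -/
def Design.IsOptimal.{r, r₁, r₂} {Θ : Type r} [Fintype Θ] {k : ℕ} (E : Environment Θ k)
    {S : Type r₁} [MeasurableSpace S] (D : Design Θ k S) : Prop :=
  D.StrategyOptimal E ∧
  ∀ (S' : Type r₂) [MeasurableSpace S'] (D' : Design Θ k S'),
    D'.StrategyOptimal E → D'.payoff E ≤ D.payoff E

/-- The recommendation mechanism given by one signal per type, whose messages are actions:
the menu consists of these signals, every type chooses the signal designated for him and takes
the recommended action. -/
def recommendation {Θ : Type*} {k : ℕ} (ρ : Θ → Signal (Fin k)) : Design Θ k (Fin k) where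
  menu := range ρ
  choice := ρ
  choice_mem := fun θ => mem_range_self θ
  action := fun _ a => a
  action_measurable := fun _ => measurable_id

/-- `P` is a partition of the state space (possibly with empty cells) that is laminar: the convex
hulls of any two cells are nested or disjoint. -/
def IsLaminarPartition {S : Type*} (P : S → Set I) : Prop :=
  Pairwise (fun s t => Disjoint (P s) (P t)) ∧ (⋃ s, P s) = univ ∧
  ∀ s t, convexHull ℝ (((↑) : I → ℝ) '' P s) ∩ convexHull ℝ (((↑) : I → ℝ) '' P t) ∈
    ({∅, convexHull ℝ (((↑) : I → ℝ) '' P s), convexHull ℝ (((↑) : I → ℝ) '' P t)} :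
      Set (Set ℝ))

/-- The signal deterministically reveals the cell of a laminar partition that contains the
state. -/
def IsLaminarPartitional {S : Type*} [MeasurableSpace S] (μ : Signal S) : Prop :=
  ∃ P : S → Set I, IsLaminarPartition P ∧
    ∀ s ω, μ.1 ω {s} = (P s).indicator (fun _ => 1) ω

section

variable {Θ : Type*} [Fintype Θ] {k : ℕ} (E : Environment Θ k)

/-- The signal of type `θ` recommends `a` with probability `p a θ`, and this recommendation induces the
posterior mean `z a θ / p a θ` (if it has positive probability; otherwise `z a θ = 0`). -/
def Induces (ρ : Θ → Signal (Fin k)) (p z : Fin k → Θ → ℝ) : Prop :=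
  ∀ a θ, (messageLaw E (ρ θ)).real {a} = p a θ ∧
    (0 < p a θ → posteriorMean E (ρ θ) a = z a θ / p a θ) ∧ (p a θ = 0 → z a θ = 0)

/-- Action `a` is optimal for type `θ` if his posterior mean is `m`. -/
def OptimalAt (θ : Θ) (m : I) (a : Fin k) : Prop :=
  ∀ b : Fin k, E.u₁ b θ * (m : ℝ) + E.u₂ b θ ≤ E.u₁ a θ * (m : ℝ) + E.u₂ a θ

/-- The cutoffs `0 = b₀ ≤ b₁ ≤ … ≤ b_k = 1` of each type: the `a`-th action is optimal exactly for
posterior means in the `a`-th interval; for an action that is never optimal both cutoffs are `1`.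
With actions numbered from `0`, the `a`-th interval is `[b θ a.castSucc, b θ a.succ]`. -/
structure IsCutoffs (b : Θ → Fin (k + 1) → ℝ) : Prop where
  zero : ∀ θ, b θ 0 = 0
  last : ∀ θ, b θ (Fin.last k) = 1
  mono : ∀ θ, Monotone (b θ)
  optimal_iff : ∀ θ a, (∃ m, OptimalAt E θ m a) →
    ∀ m : I, OptimalAt E θ m a ↔ (m : ℝ) ∈ Icc (b θ a.castSucc) (b θ a.succ)
  never : ∀ θ a, (¬ ∃ m, OptimalAt E θ m a) → b θ a.castSucc = 1 ∧ b θ a.succ = 1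

/-- The variables `(p, z, y)` of the finite-dimensional program. -/
abbrev Vars (Θ : Type*) (k : ℕ) : Type _ :=
  (Fin k → Θ → ℝ) × (Fin k → Θ → ℝ) × (Fin k → Θ → Θ → ℝ)

/-- The coefficients `h a θ = u₂ a θ + u₁ a θ * b_{a,θ}`; the coefficients `c a θ` are `u₁ a θ`. -/
def coeffH (b : Θ → Fin (k + 1) → ℝ) (a : Fin k) (θ : Θ) : ℝ :=
  E.u₂ a θ + E.u₁ a θ * b θ a.succ

/-- The objective of the finite-dimensional program. -/
def objective (x : Vars Θ k) : ℝ := ∑ θ, E.g θ * ∑ a, x.1 a θ * E.v a θ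

/-- The constraints of the finite-dimensional program, for `(p, z, y)`. -/
structure IsFeasible (b : Θ → Fin (k + 1) → ℝ) (p z : Fin k → Θ → ℝ) (y : Fin k → Θ → Θ → ℝ) :
    Prop where
  p_nonneg : ∀ a θ, 0 ≤ p a θ
  p_sum : ∀ θ, ∑ a, p a θ = 1
  majorization : ∀ θ (l : Fin k), 0 < (l : ℕ) →
    ∑ a ∈ Finset.Ici l, z a θ ≤ ∫ q in (1 - ∑ a ∈ Finset.Ici l, p a θ)..1, E.quantile q
  mean : ∀ θ, ∑ a, z a θ = ∫ q in (0 : ℝ)..1, E.quantile q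
  deviation : ∀ θ θ' a a',
    coeffH E b a θ * p a' θ' + E.u₁ a θ * (z a' θ' - b θ a.succ * p a' θ') ≤ y a' θ θ'
  incentive : ∀ θ θ', ∑ a', y a' θ θ' ≤
    ∑ a, (coeffH E b a θ * p a θ + E.u₁ a θ * (z a θ - b θ a.succ * p a θ))
  obedience : ∀ θ a, p a θ * b θ a.castSucc ≤ z a θ ∧ z a θ ≤ p a θ * b θ a.succ

/-- The feasible set of the finite-dimensional program. -/
def feasibleSet (b : Θ → Fin (k + 1) → ℝ) : Set (Vars Θ k) :=
  {x | IsFeasible E b x.1 x.2.1 x.2.2}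

/-- Optimal solutions of the finite-dimensional program. -/
def IsSolution (b : Θ → Fin (k + 1) → ℝ) (x : Vars Θ k) : Prop :=
  x ∈ feasibleSet E b ∧ IsMaxOn (objective E) (feasibleSet E b) x

end

end Persuasion

/-! A receiver with utility affine in the state cares about a message only through its posterior
mean. Hence all that matters about a mechanism with an optimal strategy is, for each type and
action, the probability `p` of taking the action and the first moment `z` of the state on that
event. The proof identifies the pairs `(p, z)` that can arise.

Necessity (`Design.StrategyOptimal.isFeasible`) is a revelation argument. Messages are pooled
according to the action taken. Obedience survives because posterior means that support an action
form an interval. A deviator who sees only the pooled message of another type gains no more than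
before, by `sum_iSup_le_signalUtility`. The majorization constraints are the bound `moment_le_call`,
read through the duality `le_integral_quantile_iff`: the tail integral of the quantile function over
mass `P` is the minimum over `t` of `t * P + E.call t`.

Sufficiency rests on `IsFeasible.put_le` and `exists_noncrossing_partition`. Obedience orders the
means by action, so the majorization constraints amount to saying that the prior dominates the law
of the means in the convex order. A dominated law with finite support is then realized by a
partition: the lowest mean is assigned an interval, and what remains of the prior still dominates
the remaining means. Successive removal of intervals gives noncrossing cells, which are laminar.

The duality also turns the nonlinear constraint into a family of affine ones, which gives convexity
and closedness; the best choice of `y` is explicit, so a maximizer exists by compactness in `(p,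
z)`. -/

namespace Persuasion

/-! ### Realizing a dominated, finitely supported law of means by a partition of an atomless
measure. -/

section Splitting

variable {μ : Measure I} [IsFiniteMeasure μ]

theorem integrable_of_bounded {α : Type*} [MeasurableSpace α] {μ : Measure α} [IsFiniteMeasure μ]
    {φ : α → ℝ} (hφ : Measurable φ) {C : ℝ} (hC : ∀ x, |φ x| ≤ C) : Integrable φ μ :=
  Integrable.of_bound hφ.aestronglyMeasurable C (Filter.Eventually.of_forall hC)

theorem integrable_state : Integrable (fun ω : I => (ω : ℝ)) μ :=
  integrable_of_bounded measurable_subtype_coe (C := 1) fun ω => by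
    rw [abs_of_nonneg ω.2.1]; exact ω.2.2

theorem integrable_put (t : ℝ) : Integrable (fun ω : I => max (t - (ω : ℝ)) 0) μ :=
  ((integrable_const t).sub integrable_state).pos_part

theorem integrable_call (t : ℝ) : Integrable (fun ω : I => max ((ω : ℝ) - t) 0) μ :=
  (integrable_state.sub (integrable_const t)).pos_part

theorem continuous_measureReal_Iic [NullSingletonClass μ] :
    Continuous fun x : I => μ.real (Iic x) := by
  have h : (fun x : I => μ.real (Iic x)) = fun x => ∫ ω, (Iic x).indicator (fun _ => (1 : ℝ)) ω ∂μ := by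
    funext x
    rw [integral_indicator measurableSet_Iic]; simp
  rw [h, continuous_iff_continuousAt]
  intro x
  refine continuousAt_of_dominated (bound := fun _ => 1)
    (Filter.Eventually.of_forall fun y =>
      (measurable_const.indicator measurableSet_Iic).aestronglyMeasurable)
    (Filter.Eventually.of_forall fun y => Filter.Eventually.of_forall fun ω => ?_)
    (integrable_const 1) ?_
  · by_cases hω : ω ∈ Iic y <;> simp [hω]
  · have hx : ∀ᵐ ω ∂μ, ω ≠ x := by
      rw [ae_iff]; simp
    filter_upwards [hx] with ω hω
    rcases lt_or_gt_of_ne hω with h | h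
    · refine (continuousAt_const (y := (1 : ℝ))).congr ?_
      filter_upwards [lt_mem_nhds h] with y hy
      rw [indicator_of_mem (show ω ∈ Iic y from hy.le)]
    · refine (continuousAt_const (y := (0 : ℝ))).congr ?_
      filter_upwards [gt_mem_nhds h] with y hy
      rw [indicator_of_notMem (show ω ∉ Iic y from not_le.2 hy)]

theorem measureReal_Iic_mono {x y : I} (h : x ≤ y) : μ.real (Iic x) ≤ μ.real (Iic y) :=
  measureReal_mono (Iic_subset_Iic.2 h)

/-- The sublevel sets of the distribution function of an atomless measure. -/
theorem exists_sublevel_eq_Iic [NullSingletonClass μ] {q : ℝ} (h0 : 0 ≤ q)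
    (h1 : q ≤ μ.real univ) :
    ∃ t : I, {ω : I | μ.real (Iic ω) ≤ q} = Iic t ∧ μ.real (Iic t) = q := by
  have hF := continuous_measureReal_Iic (μ := μ)
  have hbot : μ.real (Iic (0 : I)) = 0 := by
    have : Iic (0 : I) = {0} := by
      ext x; simp only [mem_Iic, mem_singleton_iff]
      exact ⟨fun h => le_antisymm h x.2.1, fun h => h.le⟩
    rw [this]; simp [Measure.real]
  have htop : Iic (1 : I) = univ := by
    ext x; simpa using (show x ≤ 1 from x.2.2)
  have hc : IsCompact {ω : I | μ.real (Iic ω) ≤ q} := (isClosed_le hF continuous_const).isCompact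
  obtain ⟨t, ht, ht'⟩ := hc.exists_isGreatest ⟨0, by simpa [hbot] using h0⟩
  refine ⟨t, ?_, ?_⟩
  · ext x
    exact ⟨fun hx => ht' hx, fun hx => (measureReal_Iic_mono hx).trans ht⟩
  · obtain ⟨x, hx⟩ : q ∈ range fun x : I => μ.real (Iic x) := by
      refine mem_range_of_exists_le_of_exists_ge hF ⟨0, by simpa [hbot] using h0⟩ ⟨1, ?_⟩
      rw [htop]; exact h1
    refine le_antisymm ht ?_
    rw [← hx]
    exact measureReal_Iic_mono (ht' hx.le)

/-- An atomless measure on the unit interval charges some interval with mass `p` and first moment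
`z`, provided that the mean `z / p` is neither too low nor too high. -/
theorem exists_interval [NullSingletonClass μ] {p z : ℝ} (hp : 0 ≤ p) (hpM : p ≤ μ.real univ)
    (hput : ∀ t : ℝ, t * p - z ≤ ∫ ω, max (t - (ω : ℝ)) 0 ∂μ)
    (hcall : ∀ t : ℝ, z - t * p ≤ ∫ ω, max ((ω : ℝ) - t) 0 ∂μ) :
    ∃ K : Set I, K.OrdConnected ∧ MeasurableSet K ∧ μ.real K = p ∧ ∫ ω in K, (ω : ℝ) ∂μ = z := by
  set M := μ.real univ with hM
  have hlev : ∀ q : Icc (0 : ℝ) M, ∃ t : I, {ω : I | μ.real (Iic ω) ≤ q} = Iic t ∧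
      μ.real (Iic t) = q := fun q => exists_sublevel_eq_Iic q.2.1 q.2.2
  choose T hT hTq using hlev
  have hTmono : ∀ q r : Icc (0 : ℝ) M, q ≤ r → T q ≤ T r := by
    intro q r h
    have : T q ∈ Iic (T r) := by
      rw [← hT r]; exact (hTq q).le.trans h
    exact this
  -- `Ψ q` is the first moment of the lowest mass `q`. It is 1-Lipschitz because states are at most
  -- 1.
  set Ψ : Icc (0 : ℝ) M → ℝ := fun q => ∫ ω in Iic (T q), (ω : ℝ) ∂μ with hΨ
  have hdiffset : ∀ q r : Icc (0 : ℝ) M, q ≤ r →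
      μ.real (Ioc (T q) (T r)) = r - q ∧ ∫ ω in Ioc (T q) (T r), (ω : ℝ) ∂μ = Ψ r - Ψ q := by
    intro q r h
    have hs : Ioc (T q) (T r) = Iic (T r) \ Iic (T q) := by ext; simp [and_comm]
    constructor
    · rw [hs, measureReal_sdiff (Iic_subset_Iic.2 (hTmono q r h)) measurableSet_Iic, hTq, hTq]
    · rw [hs, setIntegral_sdiff measurableSet_Iic integrable_state.integrableOn
        (Iic_subset_Iic.2 (hTmono q r h))]
  have hlip : ∀ q r : Icc (0 : ℝ) M, q ≤ r → |Ψ r - Ψ q| ≤ r - q := by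
    intro q r h
    obtain ⟨h1, h2⟩ := hdiffset q r h
    rw [← h1, ← h2]
    have := norm_setIntegral_le_of_norm_le_const (μ := μ) (s := Ioc (T q) (T r)) (C := 1)
      (f := fun ω : I => (ω : ℝ)) (measure_lt_top _ _)
      (fun ω _ => by rw [Real.norm_eq_abs, abs_of_nonneg ω.2.1]; exact ω.2.2)
    simpa using this
  have hΨc : Continuous Ψ := by
    refine (LipschitzWith.of_dist_le_mul (K := 1) fun q r => ?_).continuous
    rw [Real.dist_eq, Subtype.dist_eq, Real.dist_eq]
    rcases le_total q r with h | h
    · have := hlip q r h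
      rw [abs_sub_comm (Ψ q), abs_sub_comm (q : ℝ), abs_of_nonneg (sub_nonneg.2 (show (q : ℝ) ≤ r from h))]
      simpa using this
    · have := hlip r q h
      rw [abs_of_nonneg (sub_nonneg.2 (show (r : ℝ) ≤ q from h))]
      simpa using this
  have hmem1 : ∀ x : Icc (0 : ℝ) (M - p), (x : ℝ) ∈ Icc (0 : ℝ) M := fun x =>
    ⟨x.2.1, by linarith [x.2.2]⟩
  have hmem2 : ∀ x : Icc (0 : ℝ) (M - p), (x : ℝ) + p ∈ Icc (0 : ℝ) M := fun x =>
    ⟨by linarith [x.2.1], by linarith [x.2.2]⟩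
  -- `Φ x` is the first moment of the interval of mass `p` that lies above the lowest mass `x`. The
  -- intermediate value theorem finds `x` with `Φ x = z`.
  set Φ : Icc (0 : ℝ) (M - p) → ℝ := fun x => Ψ ⟨x + p, hmem2 x⟩ - Ψ ⟨x, hmem1 x⟩ with hΦ
  have hΦc : Continuous Φ := by
    refine (hΨc.comp ?_).sub (hΨc.comp ?_)
    · exact Continuous.subtype_mk (by fun_prop) _
    · exact Continuous.subtype_mk (by fun_prop) _
  have : PreconnectedSpace (Icc (0 : ℝ) (M - p)) := Subtype.preconnectedSpace isPreconnected_Icc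
  have hzero : Ψ ⟨0, le_rfl, by linarith⟩ = 0 := by
    rw [hΨ]
    refine setIntegral_measure_zero _ ?_
    have := hTq ⟨0, le_rfl, by linarith⟩
    simpa [measureReal_eq_zero_iff] using this
  obtain ⟨x, hx⟩ : z ∈ range Φ := by
    refine mem_range_of_exists_le_of_exists_ge hΦc ⟨⟨0, le_rfl, by linarith⟩, ?_⟩
      ⟨⟨M - p, by linarith, le_rfl⟩, ?_⟩
    -- The lowest interval has moment at most `z`: this is the put inequality with strike at its
    -- upper endpoint, where it concerns that interval alone.
    · simp only [hΦ, zero_add, hzero, sub_zero]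
      set t := T ⟨p, hp, hpM⟩ with ht
      have h1 := hput t
      have h2 : ∫ ω, max ((t : ℝ) - (ω : ℝ)) 0 ∂μ = ∫ ω in Iic t, ((t : ℝ) - ω) ∂μ := by
        rw [← integral_indicator measurableSet_Iic]
        refine integral_congr_ae (Filter.Eventually.of_forall fun ω => ?_)
        by_cases h : ω ≤ t
        · have h' : (ω : ℝ) ≤ t := h
          simp [indicator, h, h']
        · have h' : (t : ℝ) ≤ ω := (not_le.1 h).le
          simp [indicator, h, h']
      rw [h2, integral_sub (integrable_const _) integrable_state.integrableOn, setIntegral_const,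
        hTq] at h1
      simp only [smul_eq_mul] at h1
      have h3 : Ψ ⟨p, hp, hpM⟩ = ∫ ω in Iic t, (ω : ℝ) ∂μ := rfl
      rw [h3]
      nlinarith
    -- Symmetrically, the call inequality with strike at the lower endpoint of the highest interval
    -- shows that its moment is at least `z`.
    · simp only [hΦ, sub_add_cancel]
      set q : Icc (0 : ℝ) M := ⟨M - p, by linarith, by linarith⟩ with hq
      set t := T q with ht
      have htop : Iic (T ⟨M, by linarith, le_rfl⟩) = univ := by
        rw [← hT]; ext ω; simpa [hM] using measureReal_mono (subset_univ _)
      have h1 := hcall t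
      have h2 : ∫ ω, max ((ω : ℝ) - t) 0 ∂μ = ∫ ω in Ioi t, ((ω : ℝ) - t) ∂μ := by
        rw [← integral_indicator measurableSet_Ioi]
        refine integral_congr_ae (Filter.Eventually.of_forall fun ω => ?_)
        by_cases h : t < ω
        · have h' : (t : ℝ) ≤ ω := h.le
          simp [indicator, h, h']
        · have h' : (ω : ℝ) ≤ t := not_lt.1 h
          simp [indicator, h, h']
      have h4 : Ioi t = Ioc t (T ⟨M, by linarith, le_rfl⟩) := by
        rw [← Ioi_inter_Iic, htop, inter_univ]
      obtain ⟨h5, h6⟩ := hdiffset q ⟨M, by linarith, le_rfl⟩ q.2.2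
      rw [h2, integral_sub integrable_state.integrableOn (integrable_const _), setIntegral_const,
        h4, h5, h6] at h1
      simp only [smul_eq_mul, hq] at h1
      linarith
  obtain ⟨h1, h2⟩ := hdiffset ⟨x, hmem1 x⟩ ⟨x + p, hmem2 x⟩ (by
    show (x : ℝ) ≤ x + p
    linarith)
  refine ⟨Ioc _ _, ordConnected_Ioc, measurableSet_Ioc, h1.trans ?_, h2.trans hx⟩
  simp

/-- No two cells of the family alternate as `i, j, i, j`. -/
def Noncrossing {ι α : Type*} [LinearOrder α] (s : Set ι) (P : ι → Set α) : Prop :=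
  ∀ i ∈ s, ∀ j ∈ s, i ≠ j → ∀ a ∈ P i, ∀ b ∈ P j, ∀ c ∈ P i, ∀ d ∈ P j,
    a < b → b < c → c < d → False

/-- Put-call parity: with equal masses and means, the put and call forms of the convex order are
interchangeable. -/
theorem integral_put_eq_call {μ : Measure I} [IsFiniteMeasure μ] (t : ℝ) :
    ∫ ω, max (t - (ω : ℝ)) 0 ∂μ
      = t * μ.real univ - ∫ ω, (ω : ℝ) ∂μ + ∫ ω, max ((ω : ℝ) - t) 0 ∂μ := by
  have h : ∀ ω : I, max (t - (ω : ℝ)) 0 = (t - (ω : ℝ)) + max ((ω : ℝ) - t) 0 := by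
    intro ω
    rcases le_total t (ω : ℝ) with h | h
    · rw [max_eq_right (by linarith), max_eq_left (by linarith)]; ring
    · rw [max_eq_left (by linarith), max_eq_right (by linarith)]; ring
  simp_rw [h]
  have hi : Integrable (fun ω : I => t - (ω : ℝ)) μ := (integrable_const t).sub integrable_state
  rw [integral_add hi (integrable_call t), integral_sub (integrable_const t) integrable_state, integral_const]
  simp [mul_comm]

theorem sum_put_eq_call {ι : Type*} (s : Finset ι) (p z : ι → ℝ) (t : ℝ) :
    ∑ i ∈ s, max (t * p i - z i) 0
      = t * ∑ i ∈ s, p i - ∑ i ∈ s, z i + ∑ i ∈ s, max (z i - t * p i) 0 := by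
  rw [Finset.mul_sum, ← Finset.sum_sub_distrib, ← Finset.sum_add_distrib]
  refine Finset.sum_congr rfl fun i _ => ?_
  rcases le_total (t * p i) (z i) with h | h
  · rw [max_eq_right (by linarith), max_eq_left (by linarith)]; ring
  · rw [max_eq_left (by linarith), max_eq_right (by linarith)]; ring

/-- Removing an interval whose mean is the lowest of the required means preserves the convex
order. -/
theorem put_le_of_remove_interval {ι : Type*} [DecidableEq ι] {s : Finset ι} {μ : Measure I}
    [IsFiniteMeasure μ] {p z : ι → ℝ} (hp : ∀ j ∈ s, 0 ≤ p j) {i : ι} (hi : i ∈ s)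
    (hmin : ∀ j ∈ s, z i * p j ≤ z j * p i)
    (hput : ∀ t : ℝ, ∑ j ∈ s, max (t * p j - z j) 0 ≤ ∫ ω, max (t - (ω : ℝ)) 0 ∂μ)
    {K : Set I} (hK : K.OrdConnected) (hKm : MeasurableSet K) (hKp : μ.real K = p i)
    (hKz : ∫ ω in K, (ω : ℝ) ∂μ = z i) (t : ℝ) :
    ∑ j ∈ s.erase i, max (t * p j - z j) 0 ≤ ∫ ω in Kᶜ, max (t - (ω : ℝ)) 0 ∂μ := by
  have hsplit : ∀ t : ℝ, ∫ ω in Kᶜ, max (t - (ω : ℝ)) 0 ∂μ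
      = ∫ ω, max (t - (ω : ℝ)) 0 ∂μ - ∫ ω in K, max (t - (ω : ℝ)) 0 ∂μ := fun t =>
    eq_sub_of_add_eq' (integral_add_compl hKm (integrable_put t))
  have hsum : ∀ t : ℝ, ∑ j ∈ s, max (t * p j - z j) 0
      = max (t * p i - z i) 0 + ∑ j ∈ s.erase i, max (t * p j - z j) 0 := fun t =>
    (Finset.add_sum_erase s _ hi).symm
  rcases (hp i hi).eq_or_lt with h0 | hpos
  · have hK0 : μ K = 0 := by
      rw [← h0, measureReal_eq_zero_iff] at hKp; exact hKp
    rw [hsplit, setIntegral_measure_zero _ hK0, sub_zero]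
    exact le_trans (by rw [hsum t]; linarith [le_max_right (t * p i - z i) 0]) (hput t)
  set m := z i / p i with hm
  have hzm : z i = m * p i := by rw [hm]; field_simp
  have hmj : ∀ j ∈ s, m * p j ≤ z j := by
    intro j hj
    have := hmin j hj
    rw [hzm] at this
    nlinarith
  have hconst : ∀ c : ℝ, ∫ _ω in K, c ∂μ = c * p i := fun c => by
    rw [setIntegral_const, hKp, smul_eq_mul, mul_comm]
  set x := sInf K with hx
  set y := sSup K with hy
  have hxm : (x : ℝ) ≤ m := by
    have : ∫ _ω in K, (x : ℝ) ∂μ ≤ ∫ ω in K, (ω : ℝ) ∂μ :=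
      setIntegral_mono_on (integrable_const _).integrableOn integrable_state.integrableOn hKm
        fun ω hω => (sInf_le hω : x ≤ ω)
    rw [hconst, hKz, hzm] at this
    exact le_of_mul_le_mul_right this hpos
  have hmy : m ≤ y := by
    have : ∫ ω in K, (ω : ℝ) ∂μ ≤ ∫ _ω in K, (y : ℝ) ∂μ :=
      setIntegral_mono_on integrable_state.integrableOn (integrable_const _).integrableOn hKm
        fun ω hω => (le_sSup hω : ω ≤ y)
    rw [hconst, hKz, hzm] at this
    exact le_of_mul_le_mul_right this hpos
  -- For strikes above `K`, the right side loses exactly `t * p i - z i`, and the left side loses at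
  -- least as much.
  have hge : ∀ t : ℝ, (y : ℝ) ≤ t →
      ∑ j ∈ s.erase i, max (t * p j - z j) 0 ≤ ∫ ω in Kᶜ, max (t - (ω : ℝ)) 0 ∂μ := by
    intro t ht
    have h1 : ∫ ω in K, max (t - (ω : ℝ)) 0 ∂μ = t * p i - z i := by
      rw [← hKz, ← hconst t, ← integral_sub (integrable_const _).integrableOn
        integrable_state.integrableOn]
      refine setIntegral_congr_fun hKm fun ω hω => max_eq_left ?_
      have : (ω : ℝ) ≤ y := (le_sSup hω : ω ≤ y)
      linarith
    rw [hsplit, h1]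
    have h2 := hput t
    rw [hsum] at h2
    linarith [le_max_left (t * p i - z i) 0]
  -- Below the lowest mean `m` the remaining means contribute nothing.
  rcases le_or_gt t m with htm | htm
  · rw [Finset.sum_eq_zero]
    · exact integral_nonneg fun ω => le_max_right _ _
    · intro j hj
      have hj' := Finset.mem_of_mem_erase hj
      refine max_eq_right ?_
      nlinarith [hmj j hj', hp j hj']
  rcases le_or_gt (y : ℝ) t with hty | hty
  · exact hge t hty
  set L := Kᶜ ∩ Iic x with hL
  -- No state of `Kᶜ` lies strictly between `x` and `y`, so the right side is affine in the strike
  -- there. The left side is convex, vanishes at `m` and is dominated at `y`; interpolating between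
  -- `m` and `y` covers the remaining strikes.
  have haff : ∀ r : ℝ, (x : ℝ) ≤ r → r ≤ y →
      ∫ ω in Kᶜ, max (r - (ω : ℝ)) 0 ∂μ = r * μ.real L - ∫ ω in L, (ω : ℝ) ∂μ := by
    intro r hxr hry
    have h1 : ∫ ω in Kᶜ, max (r - (ω : ℝ)) 0 ∂μ
        = ∫ ω in Kᶜ, (Iic x).indicator (fun ω : I => r - (ω : ℝ)) ω ∂μ := by
      refine setIntegral_congr_fun hKm.compl fun ω hω => ?_
      by_cases h : ω ≤ x
      · have h' : (ω : ℝ) ≤ x := h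
        simp only [indicator, mem_Iic, h, if_true]
        exact max_eq_left (by linarith)
      · simp only [indicator, mem_Iic, h, if_false]
        refine max_eq_right ?_
        by_contra hlt
        have hωy : ω < y := by
          have : (ω : ℝ) < y := by linarith
          exact this
        obtain ⟨k₁, hk₁, hk₁'⟩ := sInf_lt_iff.1 (not_le.1 h)
        obtain ⟨k₂, hk₂, hk₂'⟩ := lt_sSup_iff.1 hωy
        exact hω (hK.out hk₁ hk₂ ⟨hk₁'.le, hk₂'.le⟩)
    rw [h1, setIntegral_indicator measurableSet_Iic, integral_sub (integrable_const _).integrableOn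
      integrable_state.integrableOn, setIntegral_const, smul_eq_mul, mul_comm]
  set w := (t - m) / (y - m) with hw
  have hym : 0 < (y : ℝ) - m := by linarith
  have hw0 : 0 ≤ w := div_nonneg (by linarith) hym.le
  have hw1 : w ≤ 1 := (div_le_one hym).2 (by linarith)
  have hwt : t = (1 - w) * m + w * y := by
    have : w * (y - m) = t - m := div_mul_cancel₀ _ hym.ne'
    linarith
  have hA : ∑ j ∈ s.erase i, max (t * p j - z j) 0
      ≤ w * ∑ j ∈ s.erase i, max (y * p j - z j) 0 := by
    rw [Finset.mul_sum]
    refine Finset.sum_le_sum fun j hj => ?_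
    have hj' := hmj j (Finset.mem_of_mem_erase hj)
    refine max_le ?_ (mul_nonneg hw0 (le_max_right _ _))
    have h1 := mul_le_mul_of_nonneg_left (le_max_left (y * p j - z j) 0) hw0
    have h2 := mul_nonneg (sub_nonneg.2 hw1) (sub_nonneg.2 hj')
    rw [hwt]
    linarith
  have hBy := hge y le_rfl
  have hBm : 0 ≤ ∫ ω in Kᶜ, max (m - (ω : ℝ)) 0 ∂μ := integral_nonneg fun ω => le_max_right _ _
  rw [haff _ (hxm.trans hmy) le_rfl] at hBy
  rw [haff _ hxm hmy] at hBm
  rw [haff _ (hxm.trans htm.le) hty.le]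
  have h3 := mul_le_mul_of_nonneg_left hBy hw0
  have h4 := mul_nonneg (sub_nonneg.2 hw1) hBm
  have h5 : t * μ.real L = (1 - w) * (m * μ.real L) + w * (y * μ.real L) := by
    rw [hwt]; ring
  linarith

/-- If an atomless measure dominates a finitely supported one in the convex order, then the latter is
the law of the conditional means over the cells of a noncrossing partition. -/
theorem exists_noncrossing_partition {ι : Type*} (s : Finset ι) (hs : s.Nonempty)
    (μ : Measure I) [IsFiniteMeasure μ] [NullSingletonClass μ] (p z : ι → ℝ)
    (hp : ∀ i ∈ s, 0 ≤ p i) (hz : ∀ i ∈ s, p i = 0 → z i = 0)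
    (hpsum : ∑ i ∈ s, p i = μ.real univ) (hzsum : ∑ i ∈ s, z i = ∫ ω, (ω : ℝ) ∂μ)
    (hput : ∀ t : ℝ, ∑ i ∈ s, max (t * p i - z i) 0 ≤ ∫ ω, max (t - (ω : ℝ)) 0 ∂μ) :
    ∃ P : ι → Set I,
      (∀ i ∈ s, MeasurableSet (P i) ∧ μ.real (P i) = p i ∧ ∫ ω in P i, (ω : ℝ) ∂μ = z i) ∧
      (∀ i ∈ s, ∀ j ∈ s, i ≠ j → Disjoint (P i) (P j)) ∧
      (∀ ω, ∃ i ∈ s, ω ∈ P i) ∧ Noncrossing (s : Set ι) P := by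
  classical
  induction hn : s.card using Nat.strong_induction_on generalizing s μ with
  | _ n ih =>
  -- The index of lowest mean, in cross-multiplied form; an index of zero mass satisfies this
  -- trivially and is taken first.
  obtain ⟨i, hi, hmin⟩ : ∃ i ∈ s, ∀ j ∈ s, z i * p j ≤ z j * p i := by
    by_cases h0 : ∃ i ∈ s, p i = 0
    · obtain ⟨i, hi, h⟩ := h0
      exact ⟨i, hi, fun j _ => by rw [h, hz i hi h]; simp⟩
    · push Not at h0
      obtain ⟨i, hi, h⟩ := s.exists_min_image (fun j => z j / p j) hs
      refine ⟨i, hi, fun j hj => ?_⟩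
      have hpi : 0 < p i := lt_of_le_of_ne (hp i hi) (h0 i hi).symm
      have hpj : 0 < p j := lt_of_le_of_ne (hp j hj) (h0 j hj).symm
      exact (div_le_div_iff₀ hpi hpj).1 (h j hj)
  rcases (s.erase i).eq_empty_or_nonempty with he | hne
  · have hsi : s = {i} := by rw [← Finset.insert_erase hi, he]; rfl
    subst hsi
    refine ⟨fun _ => univ, ?_, ?_, fun ω => ⟨i, hi, mem_univ ω⟩, ?_⟩
    · intro j hj
      rw [Finset.mem_singleton] at hj
      subst hj
      simp only [Finset.sum_singleton] at hpsum hzsum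
      exact ⟨MeasurableSet.univ, hpsum.symm, by rw [setIntegral_univ, hzsum]⟩
    · intro j hj l hl hjl
      rw [Finset.mem_singleton] at hj hl
      exact absurd (hj.trans hl.symm) hjl
    · intro j hj l hl hjl
      rw [Finset.mem_coe, Finset.mem_singleton] at hj hl
      exact absurd (hj.trans hl.symm) hjl
  obtain ⟨K, hK, hKm, hKp, hKz⟩ := exists_interval (μ := μ) (hp i hi)
    (hpsum ▸ Finset.single_le_sum hp hi)
    (fun t => le_trans ((le_max_left _ _).trans
      (Finset.single_le_sum (f := fun j => max (t * p j - z j) 0)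
        (fun j _ => le_max_right _ _) hi)) (hput t))
    (fun t => by
      have h1 := hput t
      rw [integral_put_eq_call, sum_put_eq_call, hpsum, hzsum, add_le_add_iff_left] at h1
      exact le_trans ((le_max_left _ _).trans
        (Finset.single_le_sum (f := fun j => max (z j - t * p j) 0)
        (fun j _ => le_max_right _ _) hi)) h1)
  have hcard : (s.erase i).card < n := by rw [← hn]; exact Finset.card_erase_lt_of_mem hi
  have hmem : ∀ {j}, j ∈ s.erase i → j ∈ s := fun h => Finset.mem_of_mem_erase h
  obtain ⟨P, hP, hdisj, hcov, hnc⟩ := ih _ hcard (s.erase i) hne (μ.restrict Kᶜ)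
    (fun j hj => hp j (hmem hj)) (fun j hj => hz j (hmem hj))
    (by
      rw [measureReal_restrict_apply_univ, measureReal_compl hKm, hKp, ← hpsum,
        ← Finset.add_sum_erase s p hi]
      ring)
    (by
      rw [eq_sub_of_add_eq' (integral_add_compl hKm integrable_state), hKz, ← hzsum,
        ← Finset.add_sum_erase s z hi]
      ring)
    (put_le_of_remove_interval hp hi hmin hput hK hKm hKp hKz) rfl
  -- The inductive partition covers all states, including the null part `K` of the restricted
  -- measure, so its cells are cut down to `Kᶜ`.
  refine ⟨fun j => if j = i then K else P j ∩ Kᶜ, ?_, ?_, ?_, ?_⟩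
  · intro j hj
    by_cases hji : j = i
    · subst hji
      simp only [if_true]
      exact ⟨hKm, hKp, hKz⟩
    · obtain ⟨h1, h2, h3⟩ := hP j (Finset.mem_erase.2 ⟨hji, hj⟩)
      simp only [hji, if_false]
      refine ⟨h1.inter hKm.compl, ?_, ?_⟩
      · rw [← h2, measureReal_restrict_apply h1]
      · rw [← h3, Measure.restrict_restrict h1]
  · intro j hj l hl hjl
    by_cases hji : j = i
    · have hli : l ≠ i := fun h => hjl (hji.trans h.symm)
      simp only [hji, hli, if_true, if_false]
      exact disjoint_compl_right.mono_right inter_subset_right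
    · by_cases hli : l = i
      · simp only [hji, hli, if_true, if_false]
        exact disjoint_compl_left.mono_left inter_subset_right
      · simp only [hji, hli, if_false]
        exact (hdisj j (Finset.mem_erase.2 ⟨hji, hj⟩) l (Finset.mem_erase.2 ⟨hli, hl⟩) hjl).mono
          inter_subset_left inter_subset_left
  · intro ω
    by_cases hω : ω ∈ K
    · exact ⟨i, hi, by simpa using hω⟩
    · obtain ⟨j, hj, hj'⟩ := hcov ω
      exact ⟨j, hmem hj, by simpa [(Finset.mem_erase.1 hj).1] using ⟨hj', hω⟩⟩
  -- An alternation that involves `K` would place a point of another cell between two points of `K`,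
  -- hence in `K`.
  · intro j hj l hl hjl a ha b hb c hc d hd hab hbc hcd
    by_cases hji : j = i
    · have hli : l ≠ i := fun h => hjl (hji.trans h.symm)
      simp only [hji, hli, if_true, if_false] at ha hb hc
      exact hb.2 (hK.out ha hc ⟨hab.le, hbc.le⟩)
    · by_cases hli : l = i
      · simp only [hji, hli, if_true, if_false] at hb hc hd
        exact hc.2 (hK.out hb hd ⟨hbc.le, hcd.le⟩)
      · simp only [hji, hli, if_false] at ha hb hc hd
        exact hnc j (Finset.mem_erase.2 ⟨hji, hj⟩) l (Finset.mem_erase.2 ⟨hli, hl⟩) hjl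
          a ha.1 b hb.1 c hc.1 d hd.1 hab hbc hcd

end Splitting

/-! ### From noncrossing cells to nested or disjoint convex hulls. -/

section Laminar

theorem convexHull_real_eq (A : Set ℝ) : convexHull ℝ A = {x | ∃ a ∈ A, ∃ b ∈ A, a ≤ x ∧ x ≤ b} := by
  refine Subset.antisymm (convexHull_min (fun x hx => ⟨x, hx, x, hx, le_rfl, le_rfl⟩) ?_) ?_
  · refine OrdConnected.convex ⟨?_⟩
    rintro x ⟨a, ha, _, _, hax, _⟩ y ⟨_, _, b, hb, _, hyb⟩ w ⟨hw1, hw2⟩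
    exact ⟨a, ha, b, hb, hax.trans hw1, hw2.trans hyb⟩
  · rintro x ⟨a, ha, b, hb, hax, hxb⟩
    exact (convex_convexHull ℝ A).ordConnected.out (subset_convexHull ℝ A ha)
      (subset_convexHull ℝ A hb) ⟨hax, hxb⟩

/-- If neither hull contains the other, some `a ∈ A` lies on one side of all of `B` and some `b ∈ B`
on one side of all of `A`. Should the hulls meet, these extreme points complete an alternation. -/
theorem hull_inter_of_noncrossing {A B : Set ℝ} (hd : Disjoint A B)
    (h1 : ∀ a ∈ A, ∀ b ∈ B, ∀ c ∈ A, ∀ d ∈ B, a < b → b < c → c < d → False)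
    (h2 : ∀ a ∈ B, ∀ b ∈ A, ∀ c ∈ B, ∀ d ∈ A, a < b → b < c → c < d → False) :
    convexHull ℝ A ∩ convexHull ℝ B ∈
      ({∅, convexHull ℝ A, convexHull ℝ B} : Set (Set ℝ)) := by
  simp only [mem_insert_iff, mem_singleton_iff, inter_eq_left, inter_eq_right]
  by_cases hAB : A ⊆ convexHull ℝ B
  · exact Or.inr (Or.inl (convexHull_min hAB (convex_convexHull ℝ B)))
  by_cases hBA : B ⊆ convexHull ℝ A
  · exact Or.inr (Or.inr (convexHull_min hBA (convex_convexHull ℝ A)))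
  left
  obtain ⟨a, ha, ha'⟩ := not_subset.1 hAB
  obtain ⟨b, hb, hb'⟩ := not_subset.1 hBA
  rw [eq_empty_iff_forall_notMem]
  rintro x ⟨hxA, hxB⟩
  rw [convexHull_real_eq] at ha' hb' hxA hxB
  obtain ⟨a₁, ha₁, a₂, ha₂, h3, h4⟩ := hxA
  obtain ⟨b₁, hb₁, b₂, hb₂, h5, h6⟩ := hxB
  have hne : ∀ {s t}, s ∈ A → t ∈ B → s ≠ t := fun hs ht h =>
    Set.disjoint_left.1 hd hs (h ▸ ht)
  have hsep : ∀ {s t}, s ∈ A → t ∈ B → s ≤ t → s < t := fun hs ht h => lt_of_le_of_ne h (hne hs ht)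
  have hsep' : ∀ {s t}, s ∈ A → t ∈ B → t ≤ s → t < s := fun hs ht h =>
    lt_of_le_of_ne h (hne hs ht).symm
  have hA : (∀ c ∈ B, a < c) ∨ ∀ c ∈ B, c < a := by
    by_contra hcon
    push Not at hcon
    obtain ⟨⟨c, hc, hc'⟩, d, hd, hd'⟩ := hcon
    exact ha' ⟨c, hc, d, hd, hc', hd'⟩
  have hB : (∀ c ∈ A, b < c) ∨ ∀ c ∈ A, c < b := by
    by_contra hcon
    push Not at hcon
    obtain ⟨⟨c, hc, hc'⟩, d, hd, hd'⟩ := hcon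
    exact hb' ⟨c, hc, d, hd, hc', hd'⟩
  rcases hA with hA | hA <;> rcases hB with hB | hB
  · exact lt_asymm (hA b hb) (hB a ha)
  · exact h1 a ha b₁ hb₁ a₂ ha₂ b hb (hA _ hb₁) (hsep' ha₂ hb₁ (h5.trans h4)) (hB _ ha₂)
  · exact h2 b hb a₁ ha₁ b₂ hb₂ a ha (hB _ ha₁) (hsep ha₁ hb₂ (h3.trans h6)) (hA _ hb₂)
  · exact lt_asymm (hA b hb) (hB a ha)

theorem IsLaminarPartition.of_noncrossing {S : Type*} {P : S → Set I}
    (hd : ∀ s t, s ≠ t → Disjoint (P s) (P t)) (hcov : ∀ ω, ∃ s, ω ∈ P s)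
    (hnc : Noncrossing univ P) : IsLaminarPartition P := by
  refine ⟨fun s t h => hd s t h, eq_univ_of_forall fun ω => mem_iUnion.2 (hcov ω), fun s t => ?_⟩
  by_cases hst : s = t
  · subst hst; simp
  refine hull_inter_of_noncrossing
    ((disjoint_image_iff Subtype.val_injective).2 (hd s t hst)) ?_ ?_
  · rintro _ ⟨a, ha, rfl⟩ _ ⟨b, hb, rfl⟩ _ ⟨c, hc, rfl⟩ _ ⟨d, hd, rfl⟩ h1 h2 h3
    exact hnc s trivial t trivial hst a ha b hb c hc d hd h1 h2 h3
  · rintro _ ⟨a, ha, rfl⟩ _ ⟨b, hb, rfl⟩ _ ⟨c, hc, rfl⟩ _ ⟨d, hd, rfl⟩ h1 h2 h3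
    exact hnc t trivial s trivial (Ne.symm hst) a ha b hb c hc d hd h1 h2 h3

end Laminar

/-! ### The quantile function and its duality with call prices. -/

section Quantile

variable {Θ : Type*} [Fintype Θ] {k : ℕ} (E : Environment Θ k)

instance : NullSingletonClass (volume : Measure I) where
  measure_singleton x := by
    rw [unitInterval.volume_def, Measure.comap_apply _ Subtype.val_injective
      (fun s hs => MeasurableSet.subtype_image measurableSet_Icc hs) _ (measurableSet_singleton x)]
    simp

instance : NullSingletonClass E.prior := nullSingletonClass_withDensity _

/-- The quantile function with values in the state space. -/
noncomputable def Environment.stateQuantile (q : ℝ) : I := sInf {x : I | q ≤ E.cdf x}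

theorem stateQuantile_mono : Monotone E.stateQuantile := fun _ _ h =>
  sInf_le_sInf fun _ hx => h.trans hx

theorem quantile_mono : Monotone E.quantile := fun _ _ h => stateQuantile_mono E h

theorem intervalIntegrable_quantile (a b : ℝ) : IntervalIntegrable E.quantile volume a b :=
  (quantile_mono E).intervalIntegrable

theorem cdf_le_one (x : I) : E.cdf x ≤ 1 := measureReal_le_one

/-- Continuity of the distribution function makes the infimum attained. For `q > 1` the set is empty
and its infimum in `I` is 1, so the equivalence would fail at `x = 1`. -/
theorem stateQuantile_le_iff {q : ℝ} (hq : q ≤ 1) (x : I) :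
    E.stateQuantile q ≤ x ↔ q ≤ E.cdf x := by
  have hc : IsClosed {x : I | q ≤ E.cdf x} :=
    isClosed_le continuous_const (continuous_measureReal_Iic (μ := E.prior))
  have hne : {x : I | q ≤ E.cdf x}.Nonempty := by
    refine ⟨1, ?_⟩
    have : Iic (1 : I) = univ := by
      ext x; simpa using (show x ≤ 1 from x.2.2)
    simpa [Environment.cdf, this] using hq
  have hmem : q ≤ E.cdf (E.stateQuantile q) := hc.sInf_mem hne
  exact ⟨fun h => hmem.trans (measureReal_Iic_mono h), fun h => sInf_le h⟩

theorem map_stateQuantile :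
    (volume.restrict (Ioc (0 : ℝ) 1)).map E.stateQuantile = E.prior := by
  symm
  refine Measure.ext_of_Iic _ _ fun x => ?_
  rw [Measure.map_apply (stateQuantile_mono E).measurable measurableSet_Iic,
    Measure.restrict_apply ((stateQuantile_mono E).measurable measurableSet_Iic)]
  have : E.stateQuantile ⁻¹' Iic x ∩ Ioc 0 1 = Ioc 0 (E.cdf x) := by
    ext q
    simp only [mem_inter_iff, mem_preimage, mem_Iic, mem_Ioc]
    constructor
    · rintro ⟨h1, h2, h3⟩
      exact ⟨h2, (stateQuantile_le_iff E h3 x).1 h1⟩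
    · rintro ⟨h1, h2⟩
      have h3 := h2.trans (cdf_le_one E x)
      exact ⟨(stateQuantile_le_iff E h3 x).2 h2, h1, h3⟩
  rw [this, Real.volume_Ioc, sub_zero, Environment.cdf, ofReal_measureReal]

theorem integral_comp_quantile {φ : ℝ → ℝ} (hφ : Continuous φ) :
    ∫ q in (0 : ℝ)..1, φ (E.quantile q) = ∫ ω, φ (ω : ℝ) ∂E.prior := by
  have hm : Continuous fun ω : I => φ (ω : ℝ) := hφ.comp continuous_subtype_val
  rw [intervalIntegral.integral_of_le zero_le_one, ← map_stateQuantile E,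
    integral_map (stateQuantile_mono E).measurable.aemeasurable hm.aestronglyMeasurable]
  rfl

/-- The price of a call option on the state with strike `t`. -/
noncomputable def Environment.call (t : ℝ) : ℝ := ∫ ω, max ((ω : ℝ) - t) 0 ∂E.prior

/-- The concave function on the right-hand side of the majorization constraints is the conjugate of
the option price. -/
theorem le_integral_quantile_iff {P S : ℝ} (hP0 : 0 ≤ P) (hP1 : P ≤ 1) :
    S ≤ ∫ q in (1 - P)..1, E.quantile q ↔ ∀ t : ℝ, S ≤ t * P + E.call t := by
  have hcall : ∀ t, E.call t = ∫ q in (0 : ℝ)..1, max (E.quantile q - t) 0 := fun t =>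
    (integral_comp_quantile E (φ := fun x => max (x - t) 0) (by fun_prop)).symm
  have hint : ∀ t a b, IntervalIntegrable (fun q => max (E.quantile q - t) 0) volume a b :=
    fun t a b => Monotone.intervalIntegrable fun x y h =>
      max_le_max (sub_le_sub_right (quantile_mono E h) t) le_rfl
  have hint' : ∀ t a b, IntervalIntegrable (fun q => E.quantile q - t) volume a b :=
    fun t a b => (intervalIntegrable_quantile E a b).sub intervalIntegrable_const
  have htail : ∀ t, ∫ q in (1 - P)..1, E.quantile q
      = t * P + ∫ q in (1 - P)..1, (E.quantile q - t) := fun t => by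
    rw [intervalIntegral.integral_sub (intervalIntegrable_quantile E _ _) intervalIntegrable_const,
      intervalIntegral.integral_const, smul_eq_mul]
    ring
  have hsplit : ∀ t, E.call t = (∫ q in (0 : ℝ)..(1 - P), max (E.quantile q - t) 0)
      + ∫ q in (1 - P)..1, max (E.quantile q - t) 0 := fun t => by
    rw [hcall, intervalIntegral.integral_add_adjacent_intervals (hint _ _ _) (hint _ _ _)]
  constructor
  · intro h t
    refine h.trans ?_
    rw [htail t, hsplit t]
    have h1 : 0 ≤ ∫ q in (0 : ℝ)..(1 - P), max (E.quantile q - t) 0 :=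
      intervalIntegral.integral_nonneg (by linarith) fun q _ => le_max_right _ _
    have h2 : ∫ q in (1 - P)..1, (E.quantile q - t) ≤ ∫ q in (1 - P)..1, max (E.quantile q - t) 0 :=
      intervalIntegral.integral_mono_on (by linarith) (hint' _ _ _) (hint _ _ _)
        fun q _ => le_max_left _ _
    linarith
  · intro h
    -- The minimizing strike: the option is exercised exactly on the upper tail of mass `P`, up to
    -- ties, so both estimates above become equalities.
    set t := E.quantile (1 - P) with ht
    refine (h t).trans (le_of_eq ?_)
    rw [htail t, hsplit t]
    have h1 : ∫ q in (0 : ℝ)..(1 - P), max (E.quantile q - t) 0 = ∫ q in (0 : ℝ)..(1 - P), (0 : ℝ) := by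
      refine intervalIntegral.integral_congr fun q hq => ?_
      rw [uIcc_of_le (by linarith)] at hq
      exact max_eq_right (sub_nonpos.2 (quantile_mono E hq.2))
    have h2 : ∫ q in (1 - P)..1, max (E.quantile q - t) 0 = ∫ q in (1 - P)..1, (E.quantile q - t) := by
      refine intervalIntegral.integral_congr fun q hq => ?_
      rw [uIcc_of_le (by linarith)] at hq
      exact max_eq_left (sub_nonneg.2 (quantile_mono E hq.1))
    rw [h1, h2]
    simp

theorem integral_quantile : ∫ q in (0 : ℝ)..1, E.quantile q = ∫ ω, (ω : ℝ) ∂E.prior :=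
  integral_comp_quantile E (φ := id) continuous_id

end Quantile

/-! ### Message laws, posterior means and utilities of a signal. -/

section Signals

variable {Θ : Type*} [Fintype Θ] {k : ℕ} (E : Environment Θ k)
  {S : Type*} [MeasurableSpace S] (κ : Signal S)

instance : IsProbabilityMeasure (messageLaw E κ) := by
  unfold messageLaw; infer_instance

instance (s : S) : IsProbabilityMeasure (belief E κ s) := by
  unfold belief; infer_instance

/-- The first moment of the state on the event that the message lies in `T`. -/
noncomputable def moment (T : Set S) : ℝ := ∫ ω, (κ.1 ω).real T * (ω : ℝ) ∂E.prior

theorem measurable_posteriorMean : Measurable (posteriorMean E κ) := by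
  unfold posteriorMean belief
  exact (StronglyMeasurable.integral_kernel
    (measurable_subtype_coe (α := ℝ)).stronglyMeasurable).measurable

theorem posteriorMean_mem (s : S) : posteriorMean E κ s ∈ I := by
  constructor
  · exact integral_nonneg fun ω => ω.2.1
  · have := integral_mono (μ := belief E κ s) integrable_state (integrable_const (1 : ℝ))
      fun ω => ω.2.2
    simpa [posteriorMean] using this

theorem integrable_posteriorMean : Integrable (posteriorMean E κ) (messageLaw E κ) :=
  integrable_of_bounded (measurable_posteriorMean E κ) (C := 1) fun s => by
    rw [abs_of_nonneg (posteriorMean_mem E κ s).1]; exact (posteriorMean_mem E κ s).2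

theorem actionUtility_eq (θ : Θ) (s : S) (a : Fin k) :
    actionUtility E κ θ s a = E.u₁ a θ * posteriorMean E κ s + E.u₂ a θ := by
  unfold actionUtility posteriorMean
  rw [integral_add (integrable_state.const_mul _) (integrable_const _), integral_const_mul]
  simp

theorem integral_messageLaw {φ : S → ℝ} (hφ : Measurable φ) {C : ℝ} (hC : ∀ s, |φ s| ≤ C) :
    ∫ s, φ s ∂(messageLaw E κ) = ∫ ω, ∫ s, φ s ∂(κ.1 ω) ∂E.prior := by
  have h := Measure.integral_compProd (μ := E.prior) (κ := κ.1) (f := fun x : I × S => φ x.2)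
    (integrable_of_bounded (hφ.comp measurable_snd) fun x => hC x.2)
  rw [← h, messageLaw, ← Measure.snd_compProd, Measure.snd, integral_map (by fun_prop)
    hφ.aestronglyMeasurable]

theorem messageLaw_real {T : Set S} (hT : MeasurableSet T) :
    (messageLaw E κ).real T = ∫ ω, (κ.1 ω).real T ∂E.prior := by
  have h := integral_messageLaw E κ (φ := T.indicator fun _ => 1)
    (measurable_const.indicator hT) (C := 1) fun s => by
      by_cases hs : s ∈ T <;> simp [hs]
  simpa [integral_indicator hT] using h

/-- Both sides integrate the state over `T` against the joint law of state and message,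
disintegrated once along messages and once along states. -/
theorem setIntegral_posteriorMean {T : Set S} (hT : MeasurableSet T) :
    ∫ s in T, posteriorMean E κ s ∂(messageLaw E κ) = moment E κ T := by
  have hm : Measurable fun x : S × I => T.indicator (fun _ => (1 : ℝ)) x.1 * (x.2 : ℝ) :=
    ((measurable_const.indicator hT).comp measurable_fst).mul
      (measurable_subtype_coe.comp measurable_snd)
  have hb : ∀ x : S × I, |T.indicator (fun _ => (1 : ℝ)) x.1 * (x.2 : ℝ)| ≤ 1 := by
    rintro ⟨s, ω⟩
    by_cases hs : s ∈ T
    · simpa [hs, abs_of_nonneg ω.2.1] using ω.2.2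
    · simp [hs]
  have h1 := Measure.integral_compProd (μ := messageLaw E κ) (κ := posterior κ.1 E.prior)
    (integrable_of_bounded hm hb)
  have h2 := Measure.integral_compProd (μ := E.prior) (κ := κ.1)
    (f := fun x : I × S => T.indicator (fun _ => (1 : ℝ)) x.2 * (x.1 : ℝ))
    (integrable_of_bounded (hm.comp measurable_swap) fun x => hb x.swap)
  rw [messageLaw, compProd_posterior_eq_map_swap, integral_map (by fun_prop)
    hm.aestronglyMeasurable] at h1
  simp only [Prod.fst_swap, Prod.snd_swap] at h1
  rw [h2] at h1
  rw [moment, ← integral_indicator hT]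
  simp only [integral_const_mul, integral_mul_const] at h1
  simp only [integral_indicator hT, integral_const, measureReal_restrict_apply_univ, smul_eq_mul,
    mul_one] at h1
  rw [h1]
  refine integral_congr_ae (Filter.Eventually.of_forall fun s => ?_)
  by_cases hs : s ∈ T <;> simp [hs, posteriorMean, belief]

theorem exists_bound_actionUtility (θ : Θ) :
    ∃ C, ∀ s a, |actionUtility E κ θ s a| ≤ C := by
  refine ⟨∑ a, (|E.u₁ a θ| + |E.u₂ a θ|), fun s a => ?_⟩
  refine le_trans ?_ (Finset.single_le_sum (f := fun a => |E.u₁ a θ| + |E.u₂ a θ|)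
    (fun a _ => by positivity) (Finset.mem_univ a))
  rw [actionUtility_eq]
  refine (abs_add_le _ _).trans (add_le_add_left ?_ _)
  rw [abs_mul, abs_of_nonneg (posteriorMean_mem E κ s).1]
  exact mul_le_of_le_one_right (abs_nonneg _) (posteriorMean_mem E κ s).2

theorem measurable_actionUtility (θ : Θ) (a : Fin k) :
    Measurable fun s => actionUtility E κ θ s a := by
  simp_rw [actionUtility_eq]
  exact ((measurable_posteriorMean E κ).const_mul _).add_const _

theorem integrable_actionUtility (θ : Θ) (a : Fin k) :
    Integrable (fun s => actionUtility E κ θ s a) (messageLaw E κ) := by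
  obtain ⟨C, hC⟩ := exists_bound_actionUtility E κ θ
  exact integrable_of_bounded (measurable_actionUtility E κ θ a) fun s => hC s a

theorem actionUtility_le_iSup (θ : Θ) (s : S) (a : Fin k) :
    actionUtility E κ θ s a ≤ ⨆ a, actionUtility E κ θ s a :=
  le_ciSup (f := fun a => actionUtility E κ θ s a) (Set.finite_range _).bddAbove a

theorem measurable_iSup_actionUtility (θ : Θ) :
    Measurable fun s => ⨆ a, actionUtility E κ θ s a :=
  Measurable.iSup fun a => measurable_actionUtility E κ θ a

theorem exists_bound_iSup_actionUtility [NeZero k] (θ : Θ) :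
    ∃ C, ∀ s, |⨆ a, actionUtility E κ θ s a| ≤ C := by
  obtain ⟨C, hC⟩ := exists_bound_actionUtility E κ θ
  exact ⟨C, fun s => abs_le.2 ⟨(abs_le.1 (hC s 0)).1.trans (actionUtility_le_iSup E κ θ s 0),
    ciSup_le fun a => (abs_le.1 (hC s a)).2⟩⟩

theorem signalUtility_eq [NeZero k] (θ : Θ) :
    signalUtility E κ θ = ∫ s, ⨆ a, actionUtility E κ θ s a ∂(messageLaw E κ) := by
  obtain ⟨C, hC⟩ := exists_bound_iSup_actionUtility E κ θ
  exact (integral_messageLaw E κ (measurable_iSup_actionUtility E κ θ) hC).symm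

theorem setIntegral_actionUtility (θ : Θ) (a : Fin k) {T : Set S} (hT : MeasurableSet T) :
    ∫ s in T, actionUtility E κ θ s a ∂(messageLaw E κ)
      = E.u₂ a θ * (messageLaw E κ).real T + E.u₁ a θ * moment E κ T := by
  simp_rw [actionUtility_eq]
  rw [integral_add ((integrable_posteriorMean E κ).integrableOn.const_mul _) (integrable_const _),
    integral_const_mul, setIntegral_posteriorMean E κ hT, setIntegral_const, smul_eq_mul]
  ring

end Signals

/-! ### Bounds on moments, and decomposition over the events on which each action is taken. -/

section Moments

variable {Θ : Type*} [Fintype Θ] {k : ℕ} (E : Environment Θ k)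
  {S : Type*} [MeasurableSpace S] (κ : Signal S)

theorem measurable_kernel_real {T : Set S} (hT : MeasurableSet T) :
    Measurable fun ω => (κ.1 ω).real T :=
  (κ.1.measurable_coe hT).ennreal_toReal

theorem integrable_kernel_real {T : Set S} (hT : MeasurableSet T) :
    Integrable (fun ω => (κ.1 ω).real T) E.prior :=
  integrable_of_bounded (measurable_kernel_real κ hT) (C := 1) fun ω => by
    rw [abs_of_nonneg measureReal_nonneg]; exact measureReal_le_one

theorem integrable_kernel_real_mul {T : Set S} (hT : MeasurableSet T) :
    Integrable (fun ω => (κ.1 ω).real T * (ω : ℝ)) E.prior :=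
  integrable_of_bounded ((measurable_kernel_real κ hT).mul measurable_subtype_coe) (C := 1)
    fun ω => by
      rw [abs_of_nonneg (mul_nonneg measureReal_nonneg ω.2.1)]
      exact mul_le_one₀ measureReal_le_one ω.2.1 ω.2.2

theorem moment_univ : moment E κ univ = ∫ ω, (ω : ℝ) ∂E.prior := by
  simp [moment]

/-- Pointwise `r * ω ≤ t * r + max (ω - t) 0` for every probability `r`. This is the source of the
majorization constraints. -/
theorem moment_le_call {T : Set S} (hT : MeasurableSet T) (t : ℝ) :
    moment E κ T ≤ t * (messageLaw E κ).real T + E.call t := by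
  rw [messageLaw_real E κ hT, ← integral_const_mul, moment, Environment.call,
    ← integral_add ((integrable_kernel_real E κ hT).const_mul t) (integrable_call t)]
  refine integral_mono (integrable_kernel_real_mul E κ hT)
    (((integrable_kernel_real E κ hT).const_mul t).add (integrable_call t)) fun ω => ?_
  have h0 : 0 ≤ (κ.1 ω).real T := measureReal_nonneg
  have h1 : (κ.1 ω).real T ≤ 1 := measureReal_le_one
  have h2 := le_max_left ((ω : ℝ) - t) 0
  have h3 := le_max_right ((ω : ℝ) - t) 0
  show (κ.1 ω).real T * (ω : ℝ) ≤ t * (κ.1 ω).real T + max ((ω : ℝ) - t) 0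
  nlinarith

/-- Since the prior has no atoms, no message of positive probability reveals the highest state. -/
theorem messageLaw_real_eq_zero_of_le_moment {T : Set S} (hT : MeasurableSet T)
    (h : (messageLaw E κ).real T ≤ moment E κ T) : (messageLaw E κ).real T = 0 := by
  rw [messageLaw_real E κ hT] at h ⊢
  have hi := (integrable_kernel_real E κ hT).sub (integrable_kernel_real_mul E κ hT)
  have hnn : 0 ≤ fun ω : I => (κ.1 ω).real T - (κ.1 ω).real T * (ω : ℝ) := fun ω => by
    have : (κ.1 ω).real T * (ω : ℝ) ≤ (κ.1 ω).real T :=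
      mul_le_of_le_one_right measureReal_nonneg ω.2.2
    show 0 ≤ (κ.1 ω).real T - (κ.1 ω).real T * (ω : ℝ)
    linarith
  have h0 : ∫ ω : I, ((κ.1 ω).real T - (κ.1 ω).real T * (ω : ℝ)) ∂E.prior = 0 := by
    refine le_antisymm ?_ (integral_nonneg hnn)
    rw [integral_sub (integrable_kernel_real E κ hT) (integrable_kernel_real_mul E κ hT)]
    exact sub_nonpos.2 h
  have hae := (integral_eq_zero_iff_of_nonneg hnn hi).1 h0
  have h1 : ∀ᵐ ω ∂E.prior, ω ≠ (1 : I) := by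
    rw [ae_iff]; simp
  refine integral_eq_zero_of_ae ?_
  filter_upwards [hae, h1] with ω hω hω1
  have h2 : (κ.1 ω).real T * (1 - (ω : ℝ)) = 0 := by
    have : (κ.1 ω).real T - (κ.1 ω).real T * (ω : ℝ) = 0 := hω
    linarith
  rcases mul_eq_zero.1 h2 with h3 | h3
  · exact h3
  · exact absurd (Subtype.ext (by simpa using (sub_eq_zero.1 h3).symm)) hω1

section Fibers

variable {α : S → Fin k} (hα : Measurable α)

include hα

theorem measurableSet_fiber (a : Fin k) : MeasurableSet (α ⁻¹' {a}) :=
  hα (measurableSet_singleton a)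

theorem sum_setIntegral_fiber {M : Measure S} {φ : S → ℝ} (hφ : Integrable φ M) :
    ∑ a, ∫ s in α ⁻¹' {a}, φ s ∂M = ∫ s, φ s ∂M := by
  rw [← integral_iUnion_fintype (measurableSet_fiber hα) (pairwise_disjoint_fiber α)
    fun a => hφ.integrableOn, ← preimage_iUnion, iUnion_of_singleton, preimage_univ,
    setIntegral_univ]

theorem sum_messageLaw_fiber (A : Finset (Fin k)) :
    ∑ a ∈ A, (messageLaw E κ).real (α ⁻¹' {a}) = (messageLaw E κ).real (α ⁻¹' A) :=
  sum_measureReal_preimage_singleton A fun a _ => measurableSet_fiber hα a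

theorem sum_moment_fiber (A : Finset (Fin k)) :
    ∑ a ∈ A, moment E κ (α ⁻¹' {a}) = moment E κ (α ⁻¹' A) := by
  unfold moment
  rw [← integral_finsetSum _ fun a _ =>
    integrable_kernel_real_mul E κ (measurableSet_fiber hα a)]
  refine integral_congr_ae (Filter.Eventually.of_forall fun ω => ?_)
  show ∑ a ∈ A, (κ.1 ω).real (α ⁻¹' {a}) * (ω : ℝ) = (κ.1 ω).real (α ⁻¹' A) * (ω : ℝ)
  rw [← Finset.sum_mul, sum_measureReal_preimage_singleton A fun a _ => measurableSet_fiber hα a]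

end Fibers

end Moments

/-! ### Every mechanism with an optimal strategy gives a feasible point. -/

section Designs

variable {Θ : Type*} [Fintype Θ] {k : ℕ} (E : Environment Θ k) {b : Θ → Fin (k + 1) → ℝ}
  {S : Type*} [MeasurableSpace S]

/-- The probability with which type `θ` takes action `a`. -/
noncomputable def Design.prob (D : Design Θ k S) (a : Fin k) (θ : Θ) : ℝ :=
  (messageLaw E (D.choice θ)).real (D.action θ ⁻¹' {a})

/-- The first moment of the state on the event that type `θ` takes action `a`. -/
noncomputable def Design.mom (D : Design Θ k S) (a : Fin k) (θ : Θ) : ℝ :=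
  moment E (D.choice θ) (D.action θ ⁻¹' {a})

/-- The least `y` that satisfies the deviation constraints for given `(p, z)`. -/
noncomputable def maxDeviation (p z : Fin k → Θ → ℝ) (a' : Fin k) (θ θ' : Θ) : ℝ :=
  ⨆ a, (E.u₂ a θ * p a' θ' + E.u₁ a θ * z a' θ')

theorem coeffH_identity (a : Fin k) (θ : Θ) (p z : ℝ) :
    coeffH E b a θ * p + E.u₁ a θ * (z - b θ a.succ * p) = E.u₂ a θ * p + E.u₁ a θ * z := by
  unfold coeffH; ring

theorem le_maxDeviation (p z : Fin k → Θ → ℝ) (a a' : Fin k) (θ θ' : Θ) :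
    E.u₂ a θ * p a' θ' + E.u₁ a θ * z a' θ' ≤ maxDeviation E p z a' θ θ' :=
  le_ciSup (f := fun a => E.u₂ a θ * p a' θ' + E.u₁ a θ * z a' θ') (Set.finite_range _).bddAbove a

-- Without actions the first and last cutoffs would coincide; a type exists because `g` sums to 1.
-- Nonemptiness makes suprema over actions genuine maxima.
variable {E} in
theorem IsCutoffs.neZero (hb : IsCutoffs E b) : NeZero k := by
  refine ⟨?_⟩
  rintro rfl
  have hne : Nonempty Θ := by
    by_contra h
    rw [not_nonempty_iff] at h
    have := E.g_sum
    simp at this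
  obtain ⟨θ⟩ := hne
  have h0 := hb.zero θ
  have h1 := hb.last θ
  rw [show Fin.last 0 = 0 from rfl, h0] at h1
  exact zero_ne_one h1

/-- The constraints of the program in a form in which all of them are closed and convex. -/
theorem isFeasible_iff {p z : Fin k → Θ → ℝ} {y : Fin k → Θ → Θ → ℝ} :
    IsFeasible E b p z y ↔
      (∀ a θ, 0 ≤ p a θ) ∧ (∀ θ, ∑ a, p a θ = 1) ∧
      (∀ θ (l : Fin k), 0 < (l : ℕ) → ∀ t : ℝ,
        ∑ a ∈ Finset.Ici l, z a θ ≤ t * ∑ a ∈ Finset.Ici l, p a θ + E.call t) ∧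
      (∀ θ, ∑ a, z a θ = ∫ ω, (ω : ℝ) ∂E.prior) ∧
      (∀ θ θ' a a', E.u₂ a θ * p a' θ' + E.u₁ a θ * z a' θ' ≤ y a' θ θ') ∧
      (∀ θ θ', ∑ a', y a' θ θ' ≤ ∑ a, (E.u₂ a θ * p a θ + E.u₁ a θ * z a θ)) ∧
      (∀ θ a, p a θ * b θ a.castSucc ≤ z a θ ∧ z a θ ≤ p a θ * b θ a.succ) := by
  have hmaj : (∀ a θ, 0 ≤ p a θ) → (∀ θ, ∑ a, p a θ = 1) → ∀ θ (l : Fin k),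
      (∑ a ∈ Finset.Ici l, z a θ ≤ ∫ q in (1 - ∑ a ∈ Finset.Ici l, p a θ)..1, E.quantile q) ↔
      ∀ t : ℝ, ∑ a ∈ Finset.Ici l, z a θ ≤ t * ∑ a ∈ Finset.Ici l, p a θ + E.call t := by
    intro h0 h1 θ l
    refine le_integral_quantile_iff E (Finset.sum_nonneg fun a _ => h0 a θ) ?_
    rw [← h1 θ]
    exact Finset.sum_le_univ_sum_of_nonneg fun a => h0 a θ
  constructor
  · intro h
    refine ⟨h.p_nonneg, h.p_sum, fun θ l hl => (hmaj h.p_nonneg h.p_sum θ l).1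
      (h.majorization θ l hl), fun θ => (h.mean θ).trans (integral_quantile E), ?_, ?_, h.obedience⟩
    · intro θ θ' a a'
      rw [← coeffH_identity (b := b)]
      exact h.deviation θ θ' a a'
    · intro θ θ'
      have := h.incentive θ θ'
      simpa only [coeffH_identity] using this
  · rintro ⟨h1, h2, h3, h4, h5, h6, h7⟩
    refine ⟨h1, h2, fun θ l hl => (hmaj h1 h2 θ l).2 (h3 θ l hl),
      fun θ => (h4 θ).trans (integral_quantile E).symm, ?_, ?_, h7⟩
    · intro θ θ' a a'
      rw [coeffH_identity]
      exact h5 θ θ' a a'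
    · intro θ θ'
      simpa only [coeffH_identity] using h6 θ θ'

-- This eliminates `y`: questions of feasibility reduce to `(p, z)`.
variable {E} in
theorem IsFeasible.maxDeviation (hb : IsCutoffs E b) {p z : Fin k → Θ → ℝ}
    {y : Fin k → Θ → Θ → ℝ} (h : IsFeasible E b p z y) :
    IsFeasible E b p z (maxDeviation E p z) := by
  have := hb.neZero
  rw [isFeasible_iff] at h ⊢
  obtain ⟨h1, h2, h3, h4, h5, h6, h7⟩ := h
  exact ⟨h1, h2, h3, h4, fun θ θ' a a' => le_maxDeviation E p z a a' θ θ', fun θ θ' =>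
    le_trans (Finset.sum_le_sum fun a' _ => ciSup_le fun a => h5 θ θ' a a') (h6 θ θ'), h7⟩

/-- Pooling messages along `α` garbles the signal, so the best reply to the pooled message is worth
no more than replying to each message. -/
theorem sum_iSup_le_signalUtility [NeZero k] (κ : Signal S) {α : S → Fin k} (hα : Measurable α)
    (θ : Θ) :
    ∑ a', ⨆ a, (E.u₂ a θ * (messageLaw E κ).real (α ⁻¹' {a'})
      + E.u₁ a θ * moment E κ (α ⁻¹' {a'})) ≤ signalUtility E κ θ := by
  obtain ⟨C, hC⟩ := exists_bound_iSup_actionUtility E κ θ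
  have hi : Integrable (fun s => ⨆ a, actionUtility E κ θ s a) (messageLaw E κ) :=
    integrable_of_bounded (measurable_iSup_actionUtility E κ θ) hC
  rw [signalUtility_eq, ← sum_setIntegral_fiber hα hi]
  refine Finset.sum_le_sum fun a' _ => ciSup_le fun a => ?_
  rw [← setIntegral_actionUtility E κ θ a (measurableSet_fiber hα a')]
  exact setIntegral_mono (integrable_actionUtility E κ θ a).integrableOn hi.integrableOn
    fun s => actionUtility_le_iSup E κ θ s a

theorem Design.payoff_eq (D : Design Θ k S) (y : Fin k → Θ → Θ → ℝ) :
    D.payoff E = objective E (D.prob E, D.mom E, y) := by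
  unfold Design.payoff objective
  refine Finset.sum_congr rfl fun θ _ => ?_
  congr 1
  have hm : Measurable fun s => E.v (D.action θ s) θ :=
    (measurable_of_finite fun a => E.v a θ).comp (D.action_measurable θ)
  have hC : ∀ s, |E.v (D.action θ s) θ| ≤ ∑ a, |E.v a θ| := fun s =>
    Finset.single_le_sum (f := fun a => |E.v a θ|) (fun _ _ => abs_nonneg _) (Finset.mem_univ _)
  rw [← integral_messageLaw E _ hm hC,
    ← sum_setIntegral_fiber (D.action_measurable θ) (integrable_of_bounded hm hC)]
  refine Finset.sum_congr rfl fun a _ => ?_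
  rw [setIntegral_congr_fun (g := fun _ => E.v a θ)
    (measurableSet_fiber (D.action_measurable θ) a) fun s hs => by
      have : D.action θ s = a := hs
      simp only [this],
    setIntegral_const, smul_eq_mul]
  rfl

variable {E} in
/-- Every mechanism with an optimal strategy of the receiver yields a feasible point. -/
theorem Design.StrategyOptimal.isFeasible (hb : IsCutoffs E b) {D : Design Θ k S}
    (hD : D.StrategyOptimal E) :
    IsFeasible E b (D.prob E) (D.mom E) (Persuasion.maxDeviation E (D.prob E) (D.mom E)) := by
  have := hb.neZero
  have hα := D.action_measurable
  obtain ⟨hact, hmenu⟩ := hD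
  rw [isFeasible_iff]
  refine ⟨fun a θ => measureReal_nonneg, fun θ => ?_, fun θ l _ t => ?_, fun θ => ?_,
    fun θ θ' a a' => le_maxDeviation E _ _ a a' θ θ', fun θ θ' => ?_, fun θ a => ?_⟩
  · exact (sum_messageLaw_fiber E _ (hα θ) Finset.univ).trans (by simp)
  · have h1 := sum_messageLaw_fiber E (D.choice θ) (hα θ) (Finset.Ici l)
    have h2 := sum_moment_fiber E (D.choice θ) (hα θ) (Finset.Ici l)
    unfold Design.prob Design.mom
    rw [h1, h2]
    exact moment_le_call E _ (hα θ (Finset.measurableSet _)) t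
  · refine (sum_moment_fiber E _ (hα θ) Finset.univ).trans ?_
    rw [Finset.coe_univ, preimage_univ, moment_univ]
  · refine (sum_iSup_le_signalUtility E (D.choice θ') (hα θ') θ).trans
      ((hmenu θ _ (D.choice_mem θ')).trans (le_of_eq ?_))
    obtain ⟨C, hC⟩ := exists_bound_iSup_actionUtility E (D.choice θ) θ
    rw [signalUtility_eq, ← sum_setIntegral_fiber (hα θ)
      (integrable_of_bounded (measurable_iSup_actionUtility E _ θ) hC)]
    refine Finset.sum_congr rfl fun a _ => ?_
    refine Eq.trans ?_ (setIntegral_actionUtility E _ θ a (measurableSet_fiber (hα θ) a))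
    refine setIntegral_congr_ae (measurableSet_fiber (hα θ) a) ?_
    filter_upwards [hact θ] with s hs hsa
    have hsa' : D.action θ s = a := hsa
    rw [hsa'] at hs
    exact le_antisymm (ciSup_le hs) (actionUtility_le_iSup E _ θ s a)
  · have hT := measurableSet_fiber (hα θ) a
    have hopt : ∀ᵐ s ∂(messageLaw E (D.choice θ)), s ∈ D.action θ ⁻¹' {a} →
        OptimalAt E θ ⟨_, posteriorMean_mem E (D.choice θ) s⟩ a := by
      filter_upwards [hact θ] with s hs hsa c
      have hsa' : D.action θ s = a := hsa
      have := hs c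
      rwa [hsa', actionUtility_eq, actionUtility_eq] at this
    by_cases hex : ∃ m, OptimalAt E θ m a
    · have hmem : ∀ᵐ s ∂(messageLaw E (D.choice θ)), s ∈ D.action θ ⁻¹' {a} →
          posteriorMean E (D.choice θ) s ∈ Icc (b θ a.castSucc) (b θ a.succ) := by
        filter_upwards [hopt] with s hs hsa
        exact (hb.optimal_iff θ a hex _).1 (hs hsa)
      have hi := (integrable_posteriorMean E (D.choice θ)).integrableOn (s := D.action θ ⁻¹' {a})
      have hc : ∀ c : ℝ, D.prob E a θ * c
          = ∫ _s in D.action θ ⁻¹' {a}, c ∂(messageLaw E (D.choice θ)) := fun c => by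
        rw [setIntegral_const, smul_eq_mul]; rfl
      rw [hc, hc, Design.mom, ← setIntegral_posteriorMean E _ hT]
      constructor
      · refine setIntegral_mono_on_ae (integrable_const _).integrableOn hi hT ?_
        filter_upwards [hmem] with s hs hsa using (hs hsa).1
      · refine setIntegral_mono_on_ae hi (integrable_const _).integrableOn hT ?_
        filter_upwards [hmem] with s hs hsa using (hs hsa).2
    -- A never optimal action is taken with probability zero, so obedience holds whatever its
    -- cutoffs are.
    · have hnull : messageLaw E (D.choice θ) (D.action θ ⁻¹' {a}) = 0 := by
        have : ∀ᵐ s ∂(messageLaw E (D.choice θ)), s ∉ D.action θ ⁻¹' {a} := by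
          filter_upwards [hopt] with s hs hsa using hex ⟨_, hs hsa⟩
        simpa only [ae_iff, not_not, ofPred_mem_eq] using this
      have hp : D.prob E a θ = 0 := by
        simp [Design.prob, measureReal_eq_zero_iff, hnull]
      have hz : D.mom E a θ = 0 := by
        rw [Design.mom, ← setIntegral_posteriorMean E _ hT, setIntegral_measure_zero _ hnull]
      rw [hp, hz]; simp

end Designs

/-! ### Every feasible point is induced by incentive compatible, laminar partitional
recommendations. -/

section Recommendations

variable {Θ : Type*} [Fintype Θ] {k : ℕ} (E : Environment Θ k) {b : Θ → Fin (k + 1) → ℝ}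
  {S : Type*} [MeasurableSpace S]

/-- A recommendation mechanism whose messages are labelled by actions through `e`. -/
def labelledRecommendation (e : S ≃ᵐ Fin k) (ρ : Θ → Signal S) : Design Θ k S where
  menu := range ρ
  choice := ρ
  choice_mem := fun θ => mem_range_self θ
  action := fun _ => e
  action_measurable := fun _ => e.measurable

theorem setIntegral_fiber_equiv (e : S ≃ᵐ Fin k) (M : Measure S) (φ : S → ℝ) (a : Fin k) :
    ∫ s in e ⁻¹' {a}, φ s ∂M = M.real (e ⁻¹' {a}) * φ (e.symm a) := by
  rw [setIntegral_congr_fun (g := fun _ => φ (e.symm a)) (measurableSet_fiber e.measurable a)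
    fun s hs => by
      have : e s = a := hs
      simp only [← this, e.symm_apply_apply],
    setIntegral_const, smul_eq_mul]

theorem messageLaw_mul_posteriorMean (e : S ≃ᵐ Fin k) (κ : Signal S) (a : Fin k) :
    (messageLaw E κ).real (e ⁻¹' {a}) * posteriorMean E κ (e.symm a)
      = moment E κ (e ⁻¹' {a}) := by
  rw [← setIntegral_fiber_equiv, setIntegral_posteriorMean E κ (measurableSet_fiber e.measurable a)]

theorem messageLaw_mul_actionUtility (e : S ≃ᵐ Fin k) (κ : Signal S) (θ : Θ) (a c : Fin k) :
    (messageLaw E κ).real (e ⁻¹' {a}) * actionUtility E κ θ (e.symm a) c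
      = E.u₂ c θ * (messageLaw E κ).real (e ⁻¹' {a}) + E.u₁ c θ * moment E κ (e ⁻¹' {a}) := by
  rw [actionUtility_eq, ← messageLaw_mul_posteriorMean]
  ring

/-- When messages correspond to actions one to one, pooling loses nothing and
`sum_iSup_le_signalUtility` holds with equality. -/
theorem signalUtility_equiv [NeZero k] (e : S ≃ᵐ Fin k) (κ : Signal S) (θ : Θ) :
    signalUtility E κ θ = ∑ a', ⨆ a, (E.u₂ a θ * (messageLaw E κ).real (e ⁻¹' {a'})
      + E.u₁ a θ * moment E κ (e ⁻¹' {a'})) := by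
  obtain ⟨C, hC⟩ := exists_bound_iSup_actionUtility E κ θ
  rw [signalUtility_eq, ← sum_setIntegral_fiber e.measurable
    (integrable_of_bounded (measurable_iSup_actionUtility E κ θ) hC)]
  refine Finset.sum_congr rfl fun a' _ => ?_
  rw [setIntegral_fiber_equiv, Real.mul_iSup_of_nonneg measureReal_nonneg]
  simp_rw [messageLaw_mul_actionUtility]

variable {E} in
/-- The recommendation mechanisms that induce feasible points are incentive compatible. -/
theorem IsFeasible.strategyOptimal (hb : IsCutoffs E b) (e : S ≃ᵐ Fin k) (ρ : Θ → Signal S)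
    {y : Fin k → Θ → Θ → ℝ}
    (h : IsFeasible E b ((labelledRecommendation e ρ).prob E)
      ((labelledRecommendation e ρ).mom E) y) :
    (labelledRecommendation e ρ).StrategyOptimal E := by
  have := hb.neZero
  rw [isFeasible_iff] at h
  obtain ⟨-, -, -, -, hdev, hinc, hob⟩ := h
  have hopt : ∀ θ a, 0 < (messageLaw E (ρ θ)).real (e ⁻¹' {a}) → ∀ c,
      actionUtility E (ρ θ) θ (e.symm a) c ≤ actionUtility E (ρ θ) θ (e.symm a) a := by
    intro θ a hpos c
    have hz := messageLaw_mul_posteriorMean E e (ρ θ) a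
    obtain ⟨h1, h2⟩ := hob θ a
    have h1' : (messageLaw E (ρ θ)).real (e ⁻¹' {a}) * b θ a.castSucc
        ≤ moment E (ρ θ) (e ⁻¹' {a}) := h1
    have h2' : moment E (ρ θ) (e ⁻¹' {a})
        ≤ (messageLaw E (ρ θ)).real (e ⁻¹' {a}) * b θ a.succ := h2
    by_cases hex : ∃ m, OptimalAt E θ m a
    · rw [← hz] at h1' h2'
      have := (hb.optimal_iff θ a hex ⟨_, posteriorMean_mem E (ρ θ) (e.symm a)⟩).2
        ⟨le_of_mul_le_mul_left h1' hpos, le_of_mul_le_mul_left h2' hpos⟩ c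
      rwa [actionUtility_eq, actionUtility_eq]
    -- Both cutoffs of a never optimal action are 1, so obedience would require it to reveal the
    -- state 1, a null event for an atomless prior.
    · rw [(hb.never θ a hex).1, mul_one] at h1'
      exact absurd (messageLaw_real_eq_zero_of_le_moment E (ρ θ)
        (measurableSet_fiber e.measurable a) h1') hpos.ne'
  constructor
  · intro θ
    have hall : ∀ a : Fin k, ∀ᵐ s ∂(messageLaw E (ρ θ)), e s = a → ∀ c : Fin k,
        actionUtility E (ρ θ) θ s c ≤ actionUtility E (ρ θ) θ s (e s) := by
      intro a
      rcases (measureReal_nonneg (μ := messageLaw E (ρ θ)) (s := e ⁻¹' {a})).eq_or_lt with h0 | hpos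
      · have hnull : messageLaw E (ρ θ) (e ⁻¹' {a}) = 0 :=
          (measureReal_eq_zero_iff).1 h0.symm
        have hae : ∀ᵐ s ∂(messageLaw E (ρ θ)), s ∉ e ⁻¹' {a} := measure_eq_zero_iff_ae_notMem.1 hnull
        filter_upwards [hae] with s hs hsa
        exact absurd hsa hs
      · refine Filter.Eventually.of_forall fun s hsa c => ?_
        subst hsa
        simpa using hopt θ (e s) hpos c
    filter_upwards [ae_all_iff.2 hall] with s hs
    exact hs (e s) rfl
  · rintro θ _ ⟨θ', rfl⟩
    refine le_trans (le_of_eq (signalUtility_equiv E e (ρ θ') θ)) (le_trans ?_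
      (sum_iSup_le_signalUtility E (ρ θ) e.measurable θ))
    refine (Finset.sum_le_sum fun a' _ => ciSup_le fun a => hdev θ θ' a a').trans
      ((hinc θ θ').trans (Finset.sum_le_sum fun a _ => ?_))
    exact le_ciSup (f := fun c => E.u₂ c θ * (messageLaw E (ρ θ)).real (e ⁻¹' {a})
      + E.u₁ c θ * moment E (ρ θ) (e ⁻¹' {a})) (Set.finite_range _).bddAbove a

/-- In product form, probability times posterior mean is the moment even at null recommendations,
which absorbs the convention on `z`. -/
theorem induces_iff {ρ : Θ → Signal (Fin k)} {p z : Fin k → Θ → ℝ} :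
    Induces E ρ p z ↔ (recommendation ρ).prob E = p ∧ (recommendation ρ).mom E = z := by
  have hprob : ∀ a θ, (recommendation ρ).prob E a θ = (messageLaw E (ρ θ)).real {a} :=
    fun _ _ => rfl
  have hmom : ∀ a θ, (messageLaw E (ρ θ)).real {a} * posteriorMean E (ρ θ) a
      = (recommendation ρ).mom E a θ := fun a θ =>
    messageLaw_mul_posteriorMean E (MeasurableEquiv.refl _) (ρ θ) a
  constructor
  · intro h
    refine ⟨funext₂ fun a θ => (h a θ).1, funext₂ fun a θ => ?_⟩
    obtain ⟨h1, h2, h3⟩ := h a θ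
    rw [← hmom, h1]
    rcases (h1 ▸ measureReal_nonneg : 0 ≤ p a θ).eq_or_lt with h0 | hpos
    · rw [← h0, h3 h0.symm, zero_mul]
    · rw [h2 hpos]
      field_simp
  · rintro ⟨rfl, rfl⟩ a θ
    refine ⟨rfl, fun hpos => ?_, fun h0 => ?_⟩
    · rw [← hmom, hprob]
      exact (mul_div_cancel_left₀ _ (ne_of_gt hpos)).symm
    · rw [← hmom, ← hprob, h0, zero_mul]

-- By parity it suffices to compare calls. Obedience makes the means increase with the action, so
-- the options in the money at strike `t` may be taken to be an upper set of actions, and the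
-- majorization constraint for that set is the required bound.
variable {E} in
theorem IsFeasible.put_le (hb : IsCutoffs E b) {p z : Fin k → Θ → ℝ} {y : Fin k → Θ → Θ → ℝ}
    (h : IsFeasible E b p z y) (θ : Θ) (t : ℝ) :
    ∑ a, max (t * p a θ - z a θ) 0 ≤ ∫ ω, max (t - (ω : ℝ)) 0 ∂E.prior := by
  rw [isFeasible_iff] at h
  obtain ⟨hp0, hp1, hmaj, hmean, -, -, hob⟩ := h
  rw [sum_put_eq_call, integral_put_eq_call, hp1, hmean, probReal_univ, add_le_add_iff_left]
  change _ ≤ E.call t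
  by_cases hex : ∃ a, t * p a θ < z a θ
  · obtain ⟨l, hl, hmin⟩ := Finset.exists_minimal
      (s := Finset.univ.filter fun a : Fin k => t * p a θ < z a θ)
      (by obtain ⟨a, ha⟩ := hex; exact ⟨a, by simpa using ha⟩)
    simp only [Finset.mem_filter, Finset.mem_univ, true_and] at hl hmin
    have hbl : t ≤ b θ l.succ := by
      by_contra hlt
      push Not at hlt
      have := (hob θ l).2
      nlinarith [hp0 l θ]
    have hsum : ∑ a, max (z a θ - t * p a θ) 0 = ∑ a ∈ Finset.Ici l, (z a θ - t * p a θ) := by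
      rw [← Finset.sum_subset (Finset.subset_univ (Finset.Ici l))]
      · refine Finset.sum_congr rfl fun a ha => max_eq_left ?_
        rw [Finset.mem_Ici] at ha
        rcases ha.eq_or_lt with rfl | hla
        · linarith
        · have h1 : b θ l.succ ≤ b θ a.castSucc := hb.mono θ (by
            rw [Fin.le_def]; simpa using hla)
          have := (hob θ a).1
          nlinarith [hp0 a θ]
      · intro a _ ha
        rw [Finset.mem_Ici, not_le] at ha
        refine max_eq_right ?_
        by_contra hlt
        push Not at hlt
        exact absurd (hmin (by linarith) ha.le) (not_le.2 ha)
    rw [hsum, Finset.sum_sub_distrib, ← Finset.mul_sum]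
    -- For the set of all actions there is no majorization constraint; the mean constraint and
    -- `moment_le_call` for an uninformative signal replace it.
    rcases Nat.eq_zero_or_pos (l : ℕ) with h0 | hpos
    · have hIci : Finset.Ici l = Finset.univ := by
        ext a; simp [Fin.le_def, h0]
      rw [hIci, hp1, hmean, mul_one]
      have := moment_le_call E (S := Unit) ⟨Kernel.const I (Measure.dirac ()), inferInstance⟩
        MeasurableSet.univ t
      rw [moment_univ, probReal_univ] at this
      linarith
    · linarith [hmaj θ l hpos t]
  · push Not at hex
    rw [Finset.sum_eq_zero fun a _ => max_eq_right (by linarith [hex a])]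
    exact integral_nonneg fun ω => le_max_right _ _

variable {E} in
/-- Every feasible point is induced by laminar partitional signals. -/
theorem IsFeasible.exists_laminar (hb : IsCutoffs E b) {p z : Fin k → Θ → ℝ}
    {y : Fin k → Θ → Θ → ℝ} (h : IsFeasible E b p z y) :
    ∃ ρ : Θ → Signal (Fin k), Induces E ρ p z ∧ ∀ θ, IsLaminarPartitional (ρ θ) := by
  have := hb.neZero
  have hput := h.put_le hb
  rw [isFeasible_iff] at h
  obtain ⟨hp0, hp1, -, hmean, -, -, hob⟩ := h
  have hsig : ∀ θ, ∃ κ : Signal (Fin k), IsLaminarPartitional κ ∧ ∀ a,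
      (messageLaw E κ).real {a} = p a θ ∧ moment E κ {a} = z a θ := by
    intro θ
    obtain ⟨P, hP, hdisj, hcov, hnc⟩ := exists_noncrossing_partition Finset.univ
      Finset.univ_nonempty E.prior (fun a => p a θ) (fun a => z a θ) (fun a _ => hp0 a θ)
      (fun a _ h0 => by
        have := hob θ a
        have h0' : p a θ = 0 := h0
        rw [h0', zero_mul, zero_mul] at this
        exact le_antisymm this.2 this.1)
      (by rw [hp1, probReal_univ]) (hmean θ) (hput θ)
    have hdisj' : ∀ a c, a ≠ c → Disjoint (P a) (P c) := fun a c =>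
      hdisj a (Finset.mem_univ a) c (Finset.mem_univ c)
    choose cell _ hcell using hcov
    have hfib : ∀ a, cell ⁻¹' {a} = P a := by
      intro a
      ext ω
      constructor
      · rintro rfl
        exact hcell ω
      · intro hω
        by_contra hne
        exact Set.disjoint_left.1 (hdisj' _ _ hne) (hcell ω) hω
    have hmeas : Measurable cell := measurable_to_countable' fun a => by
      rw [hfib]; exact (hP a (Finset.mem_univ a)).1
    have happ : ∀ a ω, Kernel.deterministic cell hmeas ω {a} = (P a).indicator (fun _ => 1) ω := by
      intro a ω
      rw [Kernel.deterministic_apply' hmeas ω (measurableSet_singleton a), ← hfib]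
      by_cases hω : cell ω = a <;> simp [hω, indicator]
    have hreal : ∀ a ω, (Kernel.deterministic cell hmeas ω).real {a}
        = (P a).indicator (fun _ => 1) ω := by
      intro a ω
      rw [Measure.real, happ]
      by_cases hω : ω ∈ P a <;> simp [hω]
    refine ⟨⟨Kernel.deterministic cell hmeas, inferInstance⟩,
      ⟨P, IsLaminarPartition.of_noncrossing hdisj' (fun ω => ⟨cell ω, hcell ω⟩)
        (by simpa using hnc), happ⟩, fun a => ?_⟩
    obtain ⟨h1, h2, h3⟩ := hP a (Finset.mem_univ a)
    constructor
    · rw [messageLaw_real E _ (measurableSet_singleton a)]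
      simp_rw [hreal]
      rw [integral_indicator h1, ← h2]
      simp
    · unfold moment
      simp_rw [hreal]
      rw [← h3, ← integral_indicator h1]
      refine integral_congr_ae (Filter.Eventually.of_forall fun ω => ?_)
      by_cases hω : ω ∈ P a <;> simp [hω]
  choose ρ hlam hρ using hsig
  exact ⟨ρ, (induces_iff E).2 ⟨funext₂ fun a θ => (hρ θ a).1, funext₂ fun a θ => (hρ θ a).2⟩, hlam⟩

variable {E} in
theorem Induces.strategyOptimal (hb : IsCutoffs E b) {ρ : Θ → Signal (Fin k)}
    {p z : Fin k → Θ → ℝ} {y : Fin k → Θ → Θ → ℝ} (hρ : Induces E ρ p z)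
    (h : IsFeasible E b p z y) : (recommendation ρ).StrategyOptimal E := by
  obtain ⟨rfl, rfl⟩ := (induces_iff E).1 hρ
  exact IsFeasible.strategyOptimal hb (MeasurableEquiv.refl _) ρ h

variable {E} in
theorem Induces.payoff_eq {ρ : Θ → Signal (Fin k)} {p z : Fin k → Θ → ℝ} (hρ : Induces E ρ p z)
    (y : Fin k → Θ → Θ → ℝ) : (recommendation ρ).payoff E = objective E (p, z, y) := by
  obtain ⟨rfl, rfl⟩ := (induces_iff E).1 hρ
  exact Design.payoff_eq E _ y

/-- A signal with its messages relabelled. -/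
noncomputable def relabel (e : S ≃ᵐ Fin k) (κ : Signal (Fin k)) : Signal S :=
  ⟨κ.1.map e.symm, Kernel.IsMarkovKernel.map _ e.symm.measurable⟩

theorem relabel_real (e : S ≃ᵐ Fin k) (κ : Signal (Fin k)) (ω : I) (a : Fin k) :
    ((relabel e κ).1 ω).real (e ⁻¹' {a}) = (κ.1 ω).real {a} := by
  rw [relabel, Kernel.map_apply _ e.symm.measurable,
    map_measureReal_apply e.symm.measurable (measurableSet_fiber e.measurable a)]
  congr 1
  ext c
  simp

theorem prob_relabel (e : S ≃ᵐ Fin k) (ρ : Θ → Signal (Fin k)) :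
    (labelledRecommendation e fun θ => relabel e (ρ θ)).prob E = (recommendation ρ).prob E := by
  funext a θ
  refine (messageLaw_real E _ (measurableSet_fiber e.measurable a)).trans
    (Eq.trans ?_ (messageLaw_real E (ρ θ) (measurableSet_singleton a)).symm)
  exact integral_congr_ae (Filter.Eventually.of_forall fun ω => relabel_real e (ρ θ) ω a)

theorem mom_relabel (e : S ≃ᵐ Fin k) (ρ : Θ → Signal (Fin k)) :
    (labelledRecommendation e fun θ => relabel e (ρ θ)).mom E = (recommendation ρ).mom E := by
  funext a θ
  refine integral_congr_ae (Filter.Eventually.of_forall fun ω => ?_)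
  exact congrArg (· * (ω : ℝ)) (relabel_real e (ρ θ) ω a)

end Recommendations

/-! ### Convexity of the program and existence of a solution. -/

section Program

variable {Θ : Type*} [Fintype Θ] {k : ℕ} (E : Environment Θ k) {b : Θ → Fin (k + 1) → ℝ}

/-- In the form of `isFeasible_iff` every constraint is affine, the majorization constraint being
one affine inequality for each strike. -/
theorem convex_feasibleSet : Convex ℝ (feasibleSet E b) := by
  rintro ⟨p, z, y⟩ hx ⟨p', z', y'⟩ hx' α β hα hβ hαβ
  have hx := (isFeasible_iff E).1 hx
  have hx' := (isFeasible_iff E).1 hx'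
  obtain ⟨h1, h2, h3, h4, h5, h6, h7⟩ := hx
  obtain ⟨h1', h2', h3', h4', h5', h6', h7'⟩ := hx'
  refine (isFeasible_iff E).2 ?_
  simp only [Prod.smul_mk, Prod.mk_add_mk, Pi.add_apply, Pi.smul_apply, smul_eq_mul] at *
  have hcomb : ∀ {r s r' s' : ℝ}, r ≤ s → r' ≤ s' → α * r + β * r' ≤ α * s + β * s' :=
    fun h h' => add_le_add (mul_le_mul_of_nonneg_left h hα) (mul_le_mul_of_nonneg_left h' hβ)
  have hconst : ∀ c : ℝ, α * c + β * c = c := fun c => by rw [← add_mul, hαβ, one_mul]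
  have hsum : ∀ (A : Finset (Fin k)) (q q' : Fin k → ℝ),
      ∑ a ∈ A, (α * q a + β * q' a) = α * ∑ a ∈ A, q a + β * ∑ a ∈ A, q' a := fun A q q' => by
    rw [Finset.sum_add_distrib, Finset.mul_sum, Finset.mul_sum]
  refine ⟨fun a θ => ?_, fun θ => ?_, fun θ l hl t => ?_, fun θ => ?_, fun θ θ' a a' => ?_,
    fun θ θ' => ?_, fun θ a => ⟨?_, ?_⟩⟩
  · exact add_nonneg (mul_nonneg hα (h1 a θ)) (mul_nonneg hβ (h1' a θ))
  · rw [hsum, h2, h2', hconst]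
  · rw [hsum, hsum]
    refine (hcomb (h3 θ l hl t) (h3' θ l hl t)).trans (le_of_eq ?_)
    linear_combination hconst (E.call t)
  · rw [hsum, h4, h4', hconst]
  · exact (le_of_eq (by ring)).trans (hcomb (h5 θ θ' a a') (h5' θ θ' a a'))
  · rw [hsum]
    refine (hcomb (h6 θ θ') (h6' θ θ')).trans (le_of_eq ?_)
    rw [← hsum]
    exact Finset.sum_congr rfl fun a _ => by ring
  · exact (le_of_eq (by ring)).trans (hcomb (h7 θ a).1 (h7' θ a).1)
  · exact (hcomb (h7 θ a).2 (h7' θ a).2).trans (le_of_eq (by ring))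

theorem isLinearMap_objective : IsLinearMap ℝ (objective E : Vars Θ k → ℝ) where
  map_add x y := by
    simp only [objective, Prod.fst_add, Pi.add_apply, add_mul, Finset.sum_add_distrib, mul_add]
  map_smul c x := by
    simp only [objective, Prod.smul_fst, Pi.smul_apply, smul_eq_mul, Finset.mul_sum]
    exact Finset.sum_congr rfl fun θ _ => Finset.sum_congr rfl fun a _ => by ring

variable {E} in
theorem exists_optimalAt [NeZero k] (θ : Θ) (m : I) : ∃ a, OptimalAt E θ m a := by
  obtain ⟨a, -, ha⟩ := Finset.exists_max_image Finset.univ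
    (fun a : Fin k => E.u₁ a θ * (m : ℝ) + E.u₂ a θ) Finset.univ_nonempty
  exact ⟨a, fun c => ha c (Finset.mem_univ c)⟩

variable {E} in
/-- The menu that contains only an uninformative signal gives a feasible point. -/
theorem exists_isFeasible (hb : IsCutoffs E b) :
    ∃ p z : Fin k → Θ → ℝ, IsFeasible E b p z (maxDeviation E p z) := by
  have := hb.neZero
  let κ : Signal Unit := ⟨Kernel.const I (Measure.dirac ()), inferInstance⟩
  choose a ha using fun θ => exists_optimalAt (E := E) θ ⟨_, posteriorMean_mem E κ ()⟩
  let D : Design Θ k Unit :=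
    { menu := {κ}
      choice := fun _ => κ
      choice_mem := fun _ => rfl
      action := fun θ _ => a θ
      action_measurable := fun _ => measurable_const }
  have hD : D.StrategyOptimal E := by
    refine ⟨fun θ => Filter.Eventually.of_forall fun s c => ?_, fun θ ν hν => ?_⟩
    · have := ha θ c
      rwa [← actionUtility_eq, ← actionUtility_eq] at this
    · have hν' : ν = κ := hν
      rw [hν']
  exact ⟨_, _, hD.isFeasible hb⟩

theorem continuous_maxDeviation [NeZero k] (a' : Fin k) (θ θ' : Θ) :
    Continuous fun x : (Fin k → Θ → ℝ) × (Fin k → Θ → ℝ) => maxDeviation E x.1 x.2 a' θ θ' := by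
  unfold maxDeviation
  simp_rw [← Finset.sup'_univ_eq_ciSup]
  exact Continuous.finset_sup'_apply _ fun a _ => by fun_prop

theorem isClosed_feasible [NeZero k] :
    IsClosed {x : (Fin k → Θ → ℝ) × (Fin k → Θ → ℝ) |
      IsFeasible E b x.1 x.2 (maxDeviation E x.1 x.2)} := by
  simp_rw [isFeasible_iff, ofPred_and, ofPred_forall]
  have hc := continuous_maxDeviation E
  refine .inter ?_ (.inter ?_ (.inter ?_ (.inter ?_ (.inter ?_ (.inter ?_ ?_)))))
  · exact isClosed_iInter fun a => isClosed_iInter fun θ => isClosed_le (by fun_prop) (by fun_prop)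
  · exact isClosed_iInter fun θ => isClosed_eq (by fun_prop) (by fun_prop)
  · exact isClosed_iInter fun θ => isClosed_iInter fun l => isClosed_iInter fun _ =>
      isClosed_iInter fun t => isClosed_le (by fun_prop) (by fun_prop)
  · exact isClosed_iInter fun θ => isClosed_eq (by fun_prop) (by fun_prop)
  · exact isClosed_iInter fun θ => isClosed_iInter fun θ' => isClosed_iInter fun a =>
      isClosed_iInter fun a' => isClosed_le (by fun_prop) (hc a' θ θ')
  · exact isClosed_iInter fun θ => isClosed_iInter fun θ' =>
      isClosed_le (continuous_finsetSum _ fun a' _ => hc a' θ θ') (by fun_prop)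
  · refine isClosed_iInter fun θ => isClosed_iInter fun a => ?_
    rw [ofPred_and]
    exact (isClosed_le (by fun_prop) (by fun_prop)).inter (isClosed_le (by fun_prop) (by fun_prop))

variable {E} in
theorem IsFeasible.mem_Icc (hb : IsCutoffs E b) {p z : Fin k → Θ → ℝ} {y : Fin k → Θ → Θ → ℝ}
    (h : IsFeasible E b p z y) : (p, z) ∈ Icc (0 : (Fin k → Θ → ℝ) × (Fin k → Θ → ℝ)) 1 := by
  have hb0 : ∀ θ i, 0 ≤ b θ i := fun θ i => hb.zero θ ▸ hb.mono θ (Fin.zero_le i)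
  have hb1 : ∀ θ i, b θ i ≤ 1 := fun θ i => hb.last θ ▸ hb.mono θ (Fin.le_last i)
  have hp1 : ∀ a θ, p a θ ≤ 1 := fun a θ => by
    rw [← h.p_sum θ]
    exact Finset.single_le_sum (f := fun a => p a θ) (fun a _ => h.p_nonneg a θ)
      (Finset.mem_univ a)
  refine ⟨⟨fun a θ => h.p_nonneg a θ, fun a θ => ?_⟩, ⟨fun a θ => hp1 a θ, fun a θ => ?_⟩⟩
  · exact (mul_nonneg (h.p_nonneg a θ) (hb0 θ _)).trans (h.obedience θ a).1
  · exact (h.obedience θ a).2.trans (mul_le_one₀ (hp1 a θ) (hb0 θ _) (hb1 θ _))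

-- The objective ignores `y`, so it is maximized over the compact set of pairs `(p, z)` that are
-- feasible with the least `y`.
variable {E} in
theorem exists_isSolution (hb : IsCutoffs E b) : ∃ x, IsSolution E b x := by
  have := hb.neZero
  obtain ⟨p₀, z₀, h₀⟩ := exists_isFeasible hb
  have hcomp : IsCompact {x : (Fin k → Θ → ℝ) × (Fin k → Θ → ℝ) |
      IsFeasible E b x.1 x.2 (maxDeviation E x.1 x.2)} :=
    isCompact_Icc.of_isClosed_subset (isClosed_feasible E) fun x hx => IsFeasible.mem_Icc hb hx
  have hcont : Continuous fun x : (Fin k → Θ → ℝ) × (Fin k → Θ → ℝ) =>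
      objective E (x.1, x.2, maxDeviation E x.1 x.2) := by
    unfold objective
    fun_prop
  obtain ⟨x, hx, hmax⟩ := hcomp.exists_isMaxOn ⟨(p₀, z₀), h₀⟩ hcont.continuousOn
  refine ⟨(x.1, x.2, maxDeviation E x.1 x.2), hx, ?_⟩
  rintro ⟨p, z, y⟩ hy
  exact hmax (show (p, z) ∈ _ from IsFeasible.maxDeviation hb hy)

end Program

/-! ### Optimal solutions and optimal mechanisms. -/

section Equivalence

variable {Θ : Type u} [Fintype Θ] {k : ℕ} {E : Environment Θ k} {b : Θ → Fin (k + 1) → ℝ}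
  {ρ : Θ → Signal (Fin k)} {p z : Fin k → Θ → ℝ}

theorem Induces.isFeasible (hb : IsCutoffs E b) (hρ : Induces E ρ p z)
    (h : (recommendation ρ).StrategyOptimal E) : IsFeasible E b p z (maxDeviation E p z) := by
  obtain ⟨rfl, rfl⟩ := (induces_iff E).1 hρ
  exact h.isFeasible hb

theorem IsSolution.isOptimal (hb : IsCutoffs E b) {y : Fin k → Θ → Θ → ℝ}
    (h : IsSolution E b (p, z, y)) (hρ : Induces E ρ p z) :
    Design.IsOptimal.{u, 0, w} E (recommendation ρ) := by
  refine ⟨hρ.strategyOptimal hb h.1, fun S' _ D' hD' => ?_⟩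
  rw [hρ.payoff_eq y, D'.payoff_eq E (maxDeviation E (D'.prob E) (D'.mom E))]
  exact h.2 (show (_, _, _) ∈ feasibleSet E b from hD'.isFeasible hb)

/-- A better feasible point would be induced by an incentive compatible mechanism, contradicting
optimality. -/
theorem Induces.isSolution (hb : IsCutoffs E b) (hρ : Induces E ρ p z)
    (h : Design.IsOptimal.{u, 0, w} E (recommendation ρ)) :
    IsSolution E b (p, z, maxDeviation E p z) := by
  refine ⟨hρ.isFeasible hb h.1, ?_⟩
  rintro ⟨p', z', y'⟩ hx
  have hx : IsFeasible E b p' z' y' := hx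
  obtain ⟨ρ', hρ', -⟩ := hx.exists_laminar hb
  obtain ⟨rfl, rfl⟩ := (induces_iff E).1 hρ'
  -- Competing mechanisms in `Design.IsOptimal` have message spaces in universe `w`, so the
  -- recommendations are relabelled by a copy of the actions there.
  let e : ULift.{w} (Fin k) ≃ᵐ Fin k := MeasurableEquiv.ulift
  have hp := prob_relabel E e ρ'
  have hz := mom_relabel E e ρ'
  rw [← hp, ← hz] at hx
  have hle := h.2 _ _ (hx.strategyOptimal hb)
  rw [hρ.payoff_eq (maxDeviation E p z), Design.payoff_eq E _ y', hp, hz] at hle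
  exact hle

end Equivalence

end Persuasion

theorem mainTheorem4 {Θ : Type u} [Fintype Θ] {k : ℕ} (E : Persuasion.Environment Θ k)
    (b : Θ → Fin (k + 1) → ℝ) (hb : Persuasion.IsCutoffs E b) :
    -- the program is a convex program and has an optimal solution
    (Convex ℝ (Persuasion.feasibleSet E b) ∧
      IsLinearMap ℝ (Persuasion.objective E : Persuasion.Vars Θ k → ℝ) ∧
      ∃ x, Persuasion.IsSolution E b x) ∧
    -- equivalence of the constraints, of the objectives and of the optimal solutions
    ((∀ p z : Fin k → Θ → ℝ,
        (∃ y, (p, z, y) ∈ Persuasion.feasibleSet E b) ↔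
          ∃ ρ, Persuasion.Induces E ρ p z ∧ (Persuasion.recommendation ρ).StrategyOptimal E) ∧
      (∀ p z y ρ, Persuasion.Induces E ρ p z →
        (Persuasion.recommendation ρ).payoff E = Persuasion.objective E (p, z, y)) ∧
      (∀ p z : Fin k → Θ → ℝ,
        (∃ y, Persuasion.IsSolution E b (p, z, y)) ↔
          ∃ ρ, Persuasion.Induces E ρ p z ∧
            Persuasion.Design.IsOptimal.{u, 0, w} E (Persuasion.recommendation ρ))) ∧
    -- every optimal solution yields optimal mechanisms, one of them laminar partitional
    (∀ p z y, Persuasion.IsSolution E b (p, z, y) →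
      (∀ ρ, Persuasion.Induces E ρ p z →
        Persuasion.Design.IsOptimal.{u, 0, w} E (Persuasion.recommendation ρ)) ∧
      ∃ ρ, Persuasion.Induces E ρ p z ∧
        (∀ θ, Persuasion.IsLaminarPartitional (ρ θ)) ∧
        Persuasion.Design.IsOptimal.{u, 0, w} E (Persuasion.recommendation ρ)) := by
  refine ⟨⟨Persuasion.convex_feasibleSet E, Persuasion.isLinearMap_objective E,
    Persuasion.exists_isSolution hb⟩, ⟨fun p z => ⟨?_, ?_⟩, fun p z y ρ hρ => hρ.payoff_eq y,
    fun p z => ⟨?_, ?_⟩⟩, fun p z y h => ⟨fun ρ hρ => h.isOptimal hb hρ, ?_⟩⟩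
  · rintro ⟨y, hy⟩
    obtain ⟨ρ, hρ, -⟩ := Persuasion.IsFeasible.exists_laminar hb hy
    exact ⟨ρ, hρ, hρ.strategyOptimal hb hy⟩
  · rintro ⟨ρ, hρ, h⟩
    exact ⟨_, hρ.isFeasible hb h⟩
  · rintro ⟨y, hy⟩
    obtain ⟨ρ, hρ, -⟩ := Persuasion.IsFeasible.exists_laminar hb hy.1
    exact ⟨ρ, hρ, hy.isOptimal hb hρ⟩
  · rintro ⟨ρ, hρ, h⟩
    exact ⟨_, hρ.isSolution hb h⟩
  · obtain ⟨ρ, hρ, hlam⟩ := Persuasion.IsFeasible.exists_laminar hb h.1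
    exact ⟨ρ, hρ, hlam, h.isOptimal hb hρ⟩
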